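/- Let $\mathrm{Nil}$ be the group of real matrices $\begin{pmatrix}1&x&z\\0&1&y\\0&0&1\end{pmatrix}$ with the left invariant metric $dx^2+dy^2+(dz-x\,dy)^2$, and let $e_1,e_2,e_3$ be the left invariant orthonormal frame dual to $dx,\ dy,\ dz-x\,dy$, taken as positively oriented. Let $f:M\to\mathrm{Nil}$ be a smooth immersion of a closed oriented surface $M$. Equip $M$ with the complex structure determined by the orientation and the induced metric, so that $M$ is a compact Riemann surface and $f$ is a conformal immersion. In a conformal parameter $z$ on $M$ (a holomorphic chart) write $f^{-1}\partial f=\sum_k Z_ke_k$, where $\partial=\partial_z$, $\bar\partial=\partial_{\bar z}$. A generating spinor is a smooth pair $\psi=(\psi_1,\psi_2)$ of local complex functions (determined up to a common sign) with $$Z_1=\tfrac i2(\bar\psi_2^2+\psi_1^2),\qquad Z_2=\tfrac12(\bar\psi_2^2-\psi_1^2),\qquad Z_3=\psi_1\bar\psi_2 .$$ Let $H$ be the mean curvature (half the trace of the second fundamental form $\langle\nabla df,N\rangle$, where $N$ is the unit normal making $(f_x,f_y,N)$ positively oriented for $z=x+iy$). Then locally there are a generating spinor $\psi$ and continuous functions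 $U,V$ (the potentials) for which $\psi$ satisfies the Dirac equation $$\partial\psi_2+U\psi_1=0,\qquad -\bar\partial\psi_1+V\psi_2=0 ,$$ the value of the product $UV$ at each point is independent of the choice of $\psi,U,V$ and so depends only on $f$ and the conformal parameter, and $UV\,\frac{i\,dz\wedge d\bar z}{2}$ is a well-defined continuous 2-form on $M$. The spinor energy $$E(M)=\int_M UV\,\frac{i\,dz\wedge d\bar z}{2}$$ is real and equals $$E(M)=\int_M\left(\frac{H^2}{4}\bigl(|\psi_1|^2+|\psi_2|^2\bigr)^2-\frac1{16}\bigl(|\psi_2|^2-|\psi_1|^2\bigr)^2\right)\frac{i\,dz\wedge d\bar z}{2}.$$ -/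

import Mathlib

open scoped Manifold ContDiff Matrix

noncomputable section

/-- The group Nil: the point `⟨x, y, z⟩` stands for the matrix `[1, x, z; 0, 1, y; 0, 0, 1]`. -/
@[ext]
structure Nil where
  x : ℝ
  y : ℝ
  z : ℝ

namespace Nil

/-- The upper unitriangular matrix of an element of Nil. -/
def toMatrix (g : Nil) : Matrix (Fin 3) (Fin 3) ℝ :=
  !![1, g.x, g.z; 0, 1, g.y; 0, 0, 1]

instance : Mul Nil := ⟨fun g h => ⟨g.x + h.x, g.y + h.y, g.z + g.x * h.y + h.z⟩⟩

instance : One Nil := ⟨⟨0, 0, 0⟩⟩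

instance : Inv Nil := ⟨fun g => ⟨-g.x, -g.y, g.x * g.y - g.z⟩⟩

theorem mul_def (g h : Nil) :
    g * h = ⟨g.x + h.x, g.y + h.y, g.z + g.x * h.y + h.z⟩ := rfl

theorem one_def : (1 : Nil) = ⟨0, 0, 0⟩ := rfl

theorem inv_def (g : Nil) : g⁻¹ = ⟨-g.x, -g.y, g.x * g.y - g.z⟩ := rfl

instance : Group Nil :=
  Group.ofLeftAxioms
    (fun a b c => by ext <;> simp only [mul_def] <;> ring)
    (fun a => by ext <;> simp [mul_def, one_def])
    (fun a => by ext <;> simp only [mul_def, one_def, inv_def] <;> ring)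

/-- The product of Nil is the product of matrices. -/
theorem toMatrix_mul (g h : Nil) : (g * h).toMatrix = g.toMatrix * h.toMatrix := by
  ext i j
  fin_cases i <;> fin_cases j <;>
    simp [toMatrix, mul_def, Matrix.mul_apply, Fin.sum_univ_three] <;> ring

/-- The basis `e₁, e₂, e₃` (indices `0, 1, 2`) of the Lie algebra of Nil. -/
def basis : Fin 3 → Matrix (Fin 3) (Fin 3) ℝ
  | 0 => !![0, 1, 0; 0, 0, 0; 0, 0, 0]
  | 1 => !![0, 0, 0; 0, 0, 1; 0, 0, 0]
  | 2 => !![0, 0, 1; 0, 0, 0; 0, 0, 0]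

/-- The coordinates of a strictly upper triangular matrix in the basis `e₁, e₂, e₃`. -/
def coord (A : Matrix (Fin 3) (Fin 3) ℝ) : Fin 3 → ℝ := ![A 0 1, A 1 2, A 0 2]

/-- The coordinates of the tangent vector `A` at `g` after left translation to the unit. The
left invariant metric makes `e₁, e₂, e₃` orthonormal, so it is the dot product of these
coordinates, see `leftCoord_eq`. -/
def leftCoord (g : Nil) (A : Matrix (Fin 3) (Fin 3) ℝ) : Fin 3 → ℝ :=
  coord (g⁻¹.toMatrix * A)

/-- The left invariant coframe is `dx, dy, dz - x dy`, hence the left invariant metric is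
`dx² + dy² + (dz - x dy)²`. -/
theorem leftCoord_eq (g : Nil) (dx dy dz : ℝ) :
    leftCoord g !![0, dx, dz; 0, 0, dy; 0, 0, 0] = ![dx, dy, dz - g.x * dy] := by
  ext i
  fin_cases i <;>
    simp [leftCoord, coord, toMatrix, inv_def, Matrix.mul_apply, Fin.sum_univ_three] <;> ring

/-- The structure constants `⟨[eᵢ, eⱼ], eₖ⟩`. -/
def structureConst (i j k : Fin 3) : ℝ :=
  coord (basis i * basis j - basis j * basis i) k

/-- The coefficient at `eᵢ` of `∇_{eₖ} eⱼ` for the Levi-Civita connection of the left invariant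
metric (the Koszul formula for a left invariant orthonormal frame). -/
def connection (k j i : Fin 3) : ℝ :=
  (1 / 2) * (structureConst k j i + structureConst i k j + structureConst i j k)

end Nil

/-- `mcForm F w v` is the left translation `F⁻¹ dF(v)` to the Lie algebra, in the basis
`e₁, e₂, e₃`, of the derivative at `w` of `F : ℂ → Nil` in the direction `v`. -/
def mcForm (F : ℂ → Nil) (w v : ℂ) : Fin 3 → ℝ :=
  Nil.leftCoord (F w) (Matrix.of fun i j => fderiv ℝ (fun u => (F u).toMatrix i j) w v)

/-- The first fundamental form `⟨dF(u), dF(v)⟩` at `w`. -/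
def firstForm (F : ℂ → Nil) (w u v : ℂ) : ℝ := mcForm F w u ⬝ᵥ mcForm F w v

/-- The covariant derivative `∇_u (dF(v))` at `w` along `F` (`u`, `v` constant vector fields),
left translated to the Lie algebra. -/
def covDeriv (F : ℂ → Nil) (w u v : ℂ) : Fin 3 → ℝ := fun i =>
  fderiv ℝ (fun t => mcForm F t v i) w u +
    ∑ k, ∑ j, mcForm F w u k * mcForm F w v j * Nil.connection k j i

/-- The unit normal `N`, left translated to the Lie algebra; `(F_x, F_y, N)` is positively
oriented, where `e₁, e₂, e₃` is a positively oriented basis. -/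
def unitNormal (F : ℂ → Nil) (w : ℂ) : Fin 3 → ℝ :=
  let n := crossProduct (mcForm F w 1) (mcForm F w Complex.I)
  (Real.sqrt (n ⬝ᵥ n))⁻¹ • n

/-- The second fundamental form `⟨∇_u dF(v), N⟩`. -/
def secondForm (F : ℂ → Nil) (w u v : ℂ) : ℝ := covDeriv F w u v ⬝ᵥ unitNormal F w

/-- The mean curvature: half the trace of the second fundamental form with respect to the
first one. -/
def meanCurvature (F : ℂ → Nil) (w : ℂ) : ℝ :=
  let g := firstForm F w
  let h := secondForm F w
  (g Complex.I Complex.I * h 1 1 - 2 * g 1 Complex.I * h 1 Complex.I + g 1 1 * h Complex.I Complex.I) /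
    (2 * (g 1 1 * g Complex.I Complex.I - g 1 Complex.I ^ 2))

/-- The Wirtinger derivative `∂ = (∂ₓ - i ∂_y) / 2`. -/
def dz (g : ℂ → ℂ) (w : ℂ) : ℂ := (fderiv ℝ g w 1 - Complex.I * fderiv ℝ g w Complex.I) / 2

/-- The Wirtinger derivative `∂̄ = (∂ₓ + i ∂_y) / 2`. -/
def dzbar (g : ℂ → ℂ) (w : ℂ) : ℂ := (fderiv ℝ g w 1 + Complex.I * fderiv ℝ g w Complex.I) / 2

/-- The components `Zₖ` of `F⁻¹ ∂F = ∑ Zₖ eₖ`. -/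
def zComp (F : ℂ → Nil) (w : ℂ) (k : Fin 3) : ℂ :=
  ((mcForm F w 1 k : ℂ) - Complex.I * (mcForm F w Complex.I k : ℂ)) / 2

/-- `ψ = (ψ₁, ψ₂)` is a (smooth) generating spinor of the conformal map `F` on the open
set `W`. -/
structure IsGeneratingSpinor (F : ℂ → Nil) (W : Set ℂ) (ψ₁ ψ₂ : ℂ → ℂ) : Prop where
  smooth₁ : ContDiffOn ℝ ∞ ψ₁ W
  smooth₂ : ContDiffOn ℝ ∞ ψ₂ W
  z₁ : ∀ w ∈ W, zComp F w 0 = Complex.I / 2 * (star (ψ₂ w) ^ 2 + ψ₁ w ^ 2)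
  z₂ : ∀ w ∈ W, zComp F w 1 = 1 / 2 * (star (ψ₂ w) ^ 2 - ψ₁ w ^ 2)
  z₃ : ∀ w ∈ W, zComp F w 2 = ψ₁ w * star (ψ₂ w)

/-- `U` and `V` are continuous potentials on `W` of a Dirac operator
`[[0, ∂], [-∂̄, 0]] + [[U, 0], [0, V]]` that annihilates `ψ`. -/
structure IsDiracPotential (W : Set ℂ) (ψ₁ ψ₂ U V : ℂ → ℂ) : Prop where
  continuous_U : ContinuousOn U W
  continuous_V : ContinuousOn V W
  dirac₁ : ∀ w ∈ W, dz ψ₂ w + U w * ψ₁ w = 0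
  dirac₂ : ∀ w ∈ W, -dzbar ψ₁ w + V w * ψ₂ w = 0

section Surface

variable {M : Type*} [TopologicalSpace M] [ChartedSpace ℂ M]

/-- The smooth map `f` from the Riemann surface `M` to Nil is a conformal immersion. -/
structure IsConformalImmersion (f : M → Nil) : Prop where
  smooth_x : ContMDiff 𝓘(ℝ, ℂ) 𝓘(ℝ, ℝ) ∞ fun p => (f p).x
  smooth_y : ContMDiff 𝓘(ℝ, ℂ) 𝓘(ℝ, ℝ) ∞ fun p => (f p).y
  smooth_z : ContMDiff 𝓘(ℝ, ℂ) 𝓘(ℝ, ℝ) ∞ fun p => (f p).z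
  conformal : ∀ φ ∈ IsManifold.maximalAtlas 𝓘(ℂ) ω M, ∀ w ∈ φ.target,
    0 < firstForm (f ∘ φ.symm) w 1 1 ∧
    firstForm (f ∘ φ.symm) w 1 1 = firstForm (f ∘ φ.symm) w Complex.I Complex.I ∧
    firstForm (f ∘ φ.symm) w 1 Complex.I = 0

/-- `c` is the value at `w` of the product `U V` of the potentials of the Dirac operator of a
generating spinor of the surface, in the conformal parameter `φ` near `w`. -/
def IsEnergyCoeff (f : M → Nil) (φ : OpenPartialHomeomorph M ℂ) (w c : ℂ) : Prop :=
  ∃ (W : Set ℂ) (ψ₁ ψ₂ U V : ℂ → ℂ), IsOpen W ∧ w ∈ W ∧ W ⊆ φ.target ∧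
    IsGeneratingSpinor (f ∘ φ.symm) W ψ₁ ψ₂ ∧ IsDiracPotential W ψ₁ ψ₂ U V ∧ c = U w * V w

/-- The coefficient `U V` of the energy form `U V (i/2) dz ∧ dz̄` in the conformal
parameter `φ`. -/
def energyCoeff (f : M → Nil) (φ : OpenPartialHomeomorph M ℂ) (w : ℂ) : ℂ :=
  Classical.epsilon (IsEnergyCoeff f φ w)

/-- The value `(ψ₁, ψ₂)` at `w` of a generating spinor of the surface in the conformal
parameter `φ` near `w`. It is unique up to a common sign of `ψ₁` and `ψ₂`; only the moduli are
used below. -/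
def spinorAt (f : M → Nil) (φ : OpenPartialHomeomorph M ℂ) (w : ℂ) : ℂ × ℂ :=
  Classical.epsilon fun s => ∃ (W : Set ℂ) (ψ₁ ψ₂ : ℂ → ℂ), IsOpen W ∧ w ∈ W ∧ W ⊆ φ.target ∧
    IsGeneratingSpinor (f ∘ φ.symm) W ψ₁ ψ₂ ∧ s = (ψ₁ w, ψ₂ w)

/-- The coefficients `c φ`, one for each holomorphic chart `φ`, define a continuous 2-form
`c φ (i/2) dz ∧ dz̄` on `M`. -/
structure IsContinuousTwoForm (c : OpenPartialHomeomorph M ℂ → ℂ → ℂ) : Prop where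
  continuousOn : ∀ φ ∈ IsManifold.maximalAtlas 𝓘(ℂ) ω M, ContinuousOn (c φ) φ.target
  transform : ∀ φ ∈ IsManifold.maximalAtlas 𝓘(ℂ) ω M,
    ∀ χ ∈ IsManifold.maximalAtlas 𝓘(ℂ) ω M, ∀ p ∈ φ.source ∩ χ.source,
    c φ (φ p) = (‖deriv (χ ∘ φ.symm) (φ p)‖ : ℂ) ^ 2 * c χ (χ p)

variable [CompactSpace M] [T2Space M]

variable (M) in
theorem exists_chartPartition : ∃ ρ : PartitionOfUnity M M Set.univ,
    ρ.IsSubordinate fun p => (chartAt ℂ p).source :=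
  PartitionOfUnity.exists_isSubordinate isClosed_univ _ (fun p => (chartAt ℂ p).open_source)
    fun p _ => Set.mem_iUnion.2 ⟨p, mem_chart_source ℂ p⟩

variable (M) in
/-- A partition of unity subordinate to the charts of `M`. -/
def chartPartition : PartitionOfUnity M M Set.univ := (exists_chartPartition M).choose

/-- The integral over the closed surface `M` of the 2-form with the expression
`c φ (i/2) dz ∧ dz̄ = c φ dx ∧ dy` in the chart `φ`, by a partition of unity; only finitely many
terms of the sum are nonzero. -/
def surfaceIntegral {E : Type*} [NormedAddCommGroup E] [NormedSpace ℝ E]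
    (c : OpenPartialHomeomorph M ℂ → ℂ → E) : E :=
  ∑ᶠ p : M, ∫ w in (chartAt ℂ p).target,
    chartPartition M p ((chartAt ℂ p).symm w) • c (chartAt ℂ p) w

/-- The spinor energy `E(M) = ∫_M U V (i/2) dz ∧ dz̄`. -/
def spinorEnergy (f : M → Nil) : ℂ := surfaceIntegral (energyCoeff f)

end Surface

end

/-! The left translated derivative of $f$ satisfies the Maurer–Cartan equations of Nil, and only the
third one has a nonzero right side, because $[e_1,e_2]=e_3$ is the only nontrivial bracket. Written
through a spinor, the first two say $\psi_2\,\partial\psi_2+\psi_1\,\bar\partial\psi_1=0$. Where the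
spinor is nonzero, this makes $(\bar\partial\psi_1,-\partial\psi_2)$ a multiple $P$ of
$(\psi_2,\psi_1)$, which is the Dirac equation with $U=V=P$ (`dz_eq`, `dzbar_eq`).

With $S=|\psi_1|^2+|\psi_2|^2$, the trace of the second fundamental form gives $\mathrm{Re}\,P=HS/2$
(`re_diracPotential`), and the third Maurer–Cartan equation gives
$\mathrm{Im}\,P=(|\psi_2|^2-|\psi_1|^2)/4$ (`im_diracPotential`). Hence $\mathrm{Re}\,P^2$ is the
stated integrand. Moreover $\bar\partial Z_3=P|\psi_2|^2-\bar P|\psi_1|^2$, so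
$\mathrm{Im}\,P^2=\frac12\mathrm{Re}\,\bar\partial Z_3$. Since $Z_3\,dz$ is a global $(1,0)$-form,
Stokes' theorem makes the integral of the imaginary part vanish.

The formula for $\mathrm{Im}\,P$ also prevents either component of the spinor from vanishing on an
open set. So continuous potentials are unique (`eq_diracPotential`). The real and imaginary parts of
$P^2$ involve only $H$, the $Z_k$ and their derivatives, so they do not depend on the spinor
(`diracPotential_sq_eq`). -/

noncomputable section

/-! ### Wirtinger calculus. -/

section Wirtinger

variable {g h τ : ℂ → ℂ} {w : ℂ}

theorem dz_mul (hg : DifferentiableAt ℝ g w) (hh : DifferentiableAt ℝ h w) :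
    dz (fun u => g u * h u) w = dz g w * h w + g w * dz h w := by
  simp only [dz, fderiv_fun_mul hg hh, _root_.add_apply,
    _root_.smul_apply, smul_eq_mul]
  ring

theorem dzbar_mul (hg : DifferentiableAt ℝ g w) (hh : DifferentiableAt ℝ h w) :
    dzbar (fun u => g u * h u) w = dzbar g w * h w + g w * dzbar h w := by
  simp only [dzbar, fderiv_fun_mul hg hh, _root_.add_apply,
    _root_.smul_apply, smul_eq_mul]
  ring

theorem dzbar_add (hg : DifferentiableAt ℝ g w) (hh : DifferentiableAt ℝ h w) :
    dzbar (fun u => g u + h u) w = dzbar g w + dzbar h w := by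
  simp only [dzbar, fderiv_fun_add hg hh, _root_.add_apply]
  ring

theorem dzbar_sub (hg : DifferentiableAt ℝ g w) (hh : DifferentiableAt ℝ h w) :
    dzbar (fun u => g u - h u) w = dzbar g w - dzbar h w := by
  simp only [dzbar, fderiv_fun_sub hg hh, _root_.sub_apply]
  ring

theorem dzbar_const_mul (c : ℂ) (hg : DifferentiableAt ℝ g w) :
    dzbar (fun u => c * g u) w = c * dzbar g w := by
  simp only [dzbar, fderiv_const_mul hg, _root_.smul_apply, smul_eq_mul]
  ring

theorem dzbar_star (hg : DifferentiableAt ℝ g w) :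
    dzbar (fun u => star (g u)) w = star (dz g w) := by
  have := ((Complex.conjCLE : ℂ →L[ℝ] ℂ).hasFDerivAt.comp w hg.hasFDerivAt).fderiv
  have h2 : (fun u => star (g u)) = (Complex.conjCLE : ℂ →L[ℝ] ℂ) ∘ g := by
    ext u; simp
  simp only [dzbar, dz, h2, this]
  simp

theorem dz_star (hg : DifferentiableAt ℝ g w) :
    dz (fun u => star (g u)) w = star (dzbar g w) := by
  have := ((Complex.conjCLE : ℂ →L[ℝ] ℂ).hasFDerivAt.comp w hg.hasFDerivAt).fderiv
  have h2 : (fun u => star (g u)) = (Complex.conjCLE : ℂ →L[ℝ] ℂ) ∘ g := by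
    ext u; simp
  simp only [dzbar, dz, h2, this]
  simp [sub_eq_add_neg]

theorem fderiv_real_apply (hτ : DifferentiableAt ℂ τ w) (v : ℂ) :
    fderiv ℝ τ w v = deriv τ w * v := by
  rw [(hτ.hasFDerivAt.restrictScalars ℝ).fderiv]
  simp [mul_comm]

theorem dzbar_of_differentiableAt (hτ : DifferentiableAt ℂ τ w) : dzbar τ w = 0 := by
  simp only [dzbar, fderiv_real_apply hτ]
  linear_combination deriv τ w / 2 * Complex.I_mul_I

/-- The splitting into a complex linear and an antilinear part; the chain rules for a holomorphic
inner map follow from it. -/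
theorem fderiv_apply_eq (g : ℂ → ℂ) (w v : ℂ) :
    fderiv ℝ g w v = dz g w * v + dzbar g w * star v := by
  have h1 : v = v.re • (1 : ℂ) + v.im • Complex.I := by
    simp
  have h2 : star v = v.re - v.im * Complex.I := by
    apply Complex.ext <;> simp
  have h3 : fderiv ℝ g w v = v.re * fderiv ℝ g w 1 + v.im * fderiv ℝ g w Complex.I := by
    conv_lhs => rw [h1]
    rw [map_add, map_smul, map_smul]; simp
  have h4 : v = v.re + v.im * Complex.I := by simp
  rw [h3, h2]
  conv_rhs => enter [1, 2]; rw [h4]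
  simp only [dz, dzbar]
  linear_combination (v.im * fderiv ℝ g w Complex.I) * Complex.I_mul_I

theorem dzbar_comp (hg : DifferentiableAt ℝ g (τ w)) (hτ : DifferentiableAt ℂ τ w) :
    dzbar (fun u => g (τ u)) w = dzbar g (τ w) * star (deriv τ w) := by
  have h1 : fderiv ℝ (fun u => g (τ u)) w = (fderiv ℝ g (τ w)).comp (fderiv ℝ τ w) :=
    fderiv_comp w hg (hτ.restrictScalars ℝ)
  simp only [dzbar, h1, ContinuousLinearMap.comp_apply, fderiv_real_apply hτ]
  rw [fderiv_apply_eq g, fderiv_apply_eq g]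
  simp only [dz, dzbar, star_mul', Complex.star_def, Complex.conj_I, map_one]
  ring_nf
  simp only [Complex.I_sq, Complex.I_pow_three]
  ring

theorem dz_comp (hg : DifferentiableAt ℝ g (τ w)) (hτ : DifferentiableAt ℂ τ w) :
    dz (fun u => g (τ u)) w = dz g (τ w) * deriv τ w := by
  have h1 : fderiv ℝ (fun u => g (τ u)) w = (fderiv ℝ g (τ w)).comp (fderiv ℝ τ w) :=
    fderiv_comp w hg (hτ.restrictScalars ℝ)
  simp only [dz, h1, ContinuousLinearMap.comp_apply, fderiv_real_apply hτ]
  rw [fderiv_apply_eq g, fderiv_apply_eq g]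
  simp only [dz, dzbar, star_mul', Complex.star_def, Complex.conj_I, map_one]
  ring_nf
  simp only [Complex.I_sq, Complex.I_pow_three]
  ring

theorem dzbar_congr (hgh : g =ᶠ[nhds w] h) : dzbar g w = dzbar h w := by
  simp only [dzbar, hgh.fderiv_eq]

theorem dz_congr (hgh : g =ᶠ[nhds w] h) : dz g w = dz h w := by
  simp only [dz, hgh.fderiv_eq]

theorem ContDiffOn.continuousOn_dz {W : Set ℂ} (hW : IsOpen W) (hg : ContDiffOn ℝ ∞ g W) :
    ContinuousOn (dz g) W := by
  have h := hg.continuousOn_fderiv_of_isOpen hW (by simp)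
  exact ((h.clm_apply continuousOn_const).sub
    (continuousOn_const.mul (h.clm_apply continuousOn_const))).div_const _

theorem ContDiffOn.continuousOn_dzbar {W : Set ℂ} (hW : IsOpen W) (hg : ContDiffOn ℝ ∞ g W) :
    ContinuousOn (dzbar g) W := by
  have h := hg.continuousOn_fderiv_of_isOpen hW (by simp)
  exact ((h.clm_apply continuousOn_const).add
    (continuousOn_const.mul (h.clm_apply continuousOn_const))).div_const _

end Wirtinger

/-- The coordinate functions of `F` are smooth on `W`. -/
structure SmoothNilOn (F : ℂ → Nil) (W : Set ℂ) : Prop where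
  x : ContDiffOn ℝ ∞ (fun u => (F u).x) W
  y : ContDiffOn ℝ ∞ (fun u => (F u).y) W
  z : ContDiffOn ℝ ∞ (fun u => (F u).z) W

theorem SmoothNilOn.mono {F : ℂ → Nil} {W W' : Set ℂ} (h : SmoothNilOn F W) (hW : W' ⊆ W) :
    SmoothNilOn F W' :=
  ⟨h.x.mono hW, h.y.mono hW, h.z.mono hW⟩

/-! ### Maurer–Cartan equations in a plane parameter. -/

section Local

variable {F : ℂ → Nil} {W : Set ℂ} {w : ℂ}

theorem mcForm_eq (F : ℂ → Nil) (w v : ℂ) :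
    mcForm F w v = ![fderiv ℝ (fun u => (F u).x) w v, fderiv ℝ (fun u => (F u).y) w v,
      fderiv ℝ (fun u => (F u).z) w v - (F w).x * fderiv ℝ (fun u => (F u).y) w v] := by
  rw [mcForm, ← Nil.leftCoord_eq]
  congr 1
  ext i j
  fin_cases i <;> fin_cases j <;> simp [Nil.toMatrix]

theorem SmoothNilOn.contDiffOn_mcForm (hF : SmoothNilOn F W) (hW : IsOpen W) (v : ℂ) (k : Fin 3) :
    ContDiffOn ℝ ∞ (fun u => mcForm F u v k) W := by
  have hx := (hF.x.fderiv_of_isOpen hW (m := ∞) (by simp)).clm_apply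
    (contDiffOn_const (c := v))
  have hy := (hF.y.fderiv_of_isOpen hW (m := ∞) (by simp)).clm_apply
    (contDiffOn_const (c := v))
  have hz := (hF.z.fderiv_of_isOpen hW (m := ∞) (by simp)).clm_apply
    (contDiffOn_const (c := v))
  simp only [mcForm_eq]
  fin_cases k
  · simpa using hx
  · simpa using hy
  · simpa using hz.sub (hF.x.mul hy)

theorem SmoothNilOn.contDiffOn_zComp (hF : SmoothNilOn F W) (hW : IsOpen W) (k : Fin 3) :
    ContDiffOn ℝ ∞ (fun u => zComp F u k) W := by
  have h1 := Complex.ofRealCLM.contDiff.comp_contDiffOn (hF.contDiffOn_mcForm hW 1 k)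
  have h2 := Complex.ofRealCLM.contDiff.comp_contDiffOn (hF.contDiffOn_mcForm hW Complex.I k)
  exact (h1.sub (contDiffOn_const.mul h2)).div_const 2

/-- The mixed partial derivatives of a smooth function agree. -/
theorem fderiv_fderiv_comm {u : ℂ → ℝ} (hu : ContDiffOn ℝ ∞ u W) (hW : IsOpen W) (hw : w ∈ W)
    (a b : ℂ) :
    fderiv ℝ (fun t => fderiv ℝ u t a) w b = fderiv ℝ (fun t => fderiv ℝ u t b) w a := by
  have h1 : ContDiffAt ℝ ∞ u w := hu.contDiffAt (hW.mem_nhds hw)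
  have h2 : IsSymmSndFDerivAt ℝ u w := h1.isSymmSndFDerivAt
    (by simpa using WithTop.coe_le_coe.2 (le_top : (2 : ℕ∞) ≤ ⊤))
  have h3 : DifferentiableAt ℝ (fderiv ℝ u) w :=
    (h1.fderiv_right (m := ∞) (by simp)).differentiableAt (by simp)
  have h4 (c d : ℂ) : fderiv ℝ (fun t => fderiv ℝ u t c) w d = fderiv ℝ (fderiv ℝ u) w d c := by
    rw [fderiv_clm_apply h3 (differentiableAt_const c)]
    simp
  rw [h4, h4]
  exact h2 b a

theorem SmoothNilOn.differentiableAt_mcForm (hF : SmoothNilOn F W) (hW : IsOpen W) (hw : w ∈ W)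
    (v : ℂ) (k : Fin 3) : DifferentiableAt ℝ (fun u => mcForm F u v k) w :=
  ((hF.contDiffOn_mcForm hW v k).contDiffAt (hW.mem_nhds hw)).differentiableAt (by simp)

/-- The real part is the divergence, which enters the mean curvature; the imaginary part is the
curl, which the Maurer–Cartan equations prescribe. -/
theorem SmoothNilOn.dzbar_zComp (hF : SmoothNilOn F W) (hW : IsOpen W) (hw : w ∈ W) (k : Fin 3) :
    4 * dzbar (fun u => zComp F u k) w =
      ((fderiv ℝ (fun u => mcForm F u 1 k) w 1 +
        fderiv ℝ (fun u => mcForm F u Complex.I k) w Complex.I : ℝ) : ℂ) +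
      ((fderiv ℝ (fun u => mcForm F u 1 k) w Complex.I -
        fderiv ℝ (fun u => mcForm F u Complex.I k) w 1 : ℝ) : ℂ) * Complex.I := by
  have h1 := (hF.differentiableAt_mcForm hW hw 1 k).hasFDerivAt
  have h2 := (hF.differentiableAt_mcForm hW hw Complex.I k).hasFDerivAt
  have h3 := Complex.ofRealCLM.hasFDerivAt.comp w h1
  have h4 := Complex.ofRealCLM.hasFDerivAt.comp w h2
  have h5 := (h3.sub (h4.const_mul Complex.I)).mul_const (2 : ℂ)⁻¹
  have h6 := (h5.congr_of_eventuallyEq (f₁ := fun u => zComp F u k)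
    (Filter.Eventually.of_forall fun u => by simp [zComp, div_eq_mul_inv])).fderiv
  simp only [dzbar, h6]
  simp
  ring_nf
  simp only [Complex.I_sq]
  ring

/-- The Maurer–Cartan equations of the left invariant coframe. -/
theorem SmoothNilOn.maurerCartan (hF : SmoothNilOn F W) (hW : IsOpen W) (hw : w ∈ W) (k : Fin 3) :
    fderiv ℝ (fun u => mcForm F u 1 k) w Complex.I -
      fderiv ℝ (fun u => mcForm F u Complex.I k) w 1 =
    ![0, 0, mcForm F w 1 0 * mcForm F w Complex.I 1 -
      mcForm F w 1 1 * mcForm F w Complex.I 0] k := by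
  have e1 := fderiv_fderiv_comm hF.x hW hw 1 Complex.I
  have e2 := fderiv_fderiv_comm hF.y hW hw 1 Complex.I
  have e3 := fderiv_fderiv_comm hF.z hW hw 1 Complex.I
  have dx : DifferentiableAt ℝ (fun u => (F u).x) w :=
    (hF.x.contDiffAt (hW.mem_nhds hw)).differentiableAt (by simp)
  have d2 (u : ℂ → ℝ) (hu : ContDiffOn ℝ ∞ u W) (v : ℂ) :
      DifferentiableAt ℝ (fun t => fderiv ℝ u t v) w :=
    (((hu.fderiv_of_isOpen hW (m := ∞) (by simp)).clm_apply
      (contDiffOn_const (c := v))).contDiffAt (hW.mem_nhds hw)).differentiableAt (by simp)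
  -- The product rule for $dz-x\,dy$. After the second derivatives cancel by symmetry, the term
  -- $dx\wedge dy$ remains.
  have key (v v' : ℂ) : fderiv ℝ (fun u => mcForm F u v 2) w v' =
      fderiv ℝ (fun t => fderiv ℝ (fun u => (F u).z) t v) w v' -
      ((F w).x * fderiv ℝ (fun t => fderiv ℝ (fun u => (F u).y) t v) w v' +
        fderiv ℝ (fun u => (F u).y) w v * fderiv ℝ (fun u => (F u).x) w v') := by
    have := ((d2 _ hF.z v).hasFDerivAt.sub (dx.hasFDerivAt.mul (d2 _ hF.y v).hasFDerivAt)).fderiv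
    have h6 : (fun u => mcForm F u v 2) = (fun t => fderiv ℝ (fun u => (F u).z) t v) -
        (fun u => (F u).x) * (fun t => fderiv ℝ (fun u => (F u).y) t v) := by
      ext u; simp [mcForm_eq]
    rw [h6, this]
    simp
  fin_cases k
  · simpa [mcForm_eq, sub_eq_zero] using e1
  · simpa [mcForm_eq, sub_eq_zero] using e2
  · simp only [Fin.reduceFinMk, key, e2, e3]
    simp [mcForm_eq]
    ring

end Local

/-! ### Dirac equation and the real and imaginary parts of the potential. -/

section Spinor

variable {F : ℂ → Nil} {W : Set ℂ} {ψ₁ ψ₂ : ℂ → ℂ} {w : ℂ}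

theorem mcForm_one_eq (F : ℂ → Nil) (w : ℂ) (k : Fin 3) :
    mcForm F w 1 k = 2 * (zComp F w k).re := by
  simp [zComp]
  ring

theorem mcForm_I_eq (F : ℂ → Nil) (w : ℂ) (k : Fin 3) :
    mcForm F w Complex.I k = -2 * (zComp F w k).im := by
  simp [zComp]
  ring

/-- The sum of the squared moduli of a spinor. -/
def spinorDensity (a b : ℂ) : ℝ := ‖a‖ ^ 2 + ‖b‖ ^ 2

/-- The common potential `U = V` of the Dirac operator that annihilates the spinor. -/
def diracPotential (ψ₁ ψ₂ : ℂ → ℂ) (w : ℂ) : ℂ :=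
  (dzbar ψ₁ w * star (ψ₂ w) - dz ψ₂ w * star (ψ₁ w)) / spinorDensity (ψ₁ w) (ψ₂ w)

theorem spinorDensity_coe (a b : ℂ) :
    (spinorDensity a b : ℂ) = a * star a + b * star b := by
  simp [spinorDensity, Complex.mul_conj, Complex.normSq_eq_norm_sq]

namespace IsGeneratingSpinor

theorem mono (hψ : IsGeneratingSpinor F W ψ₁ ψ₂) {W' : Set ℂ} (h : W' ⊆ W) :
    IsGeneratingSpinor F W' ψ₁ ψ₂ :=
  ⟨hψ.smooth₁.mono h, hψ.smooth₂.mono h, fun u hu => hψ.z₁ u (h hu), fun u hu => hψ.z₂ u (h hu),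
    fun u hu => hψ.z₃ u (h hu)⟩

variable (hψ : IsGeneratingSpinor F W ψ₁ ψ₂) (hW : IsOpen W) (hw : w ∈ W)
include hψ hW hw

theorem differentiableAt₁ : DifferentiableAt ℝ ψ₁ w :=
  (hψ.smooth₁.contDiffAt (hW.mem_nhds hw)).differentiableAt (by simp)

theorem differentiableAt₂ : DifferentiableAt ℝ ψ₂ w :=
  (hψ.smooth₂.contDiffAt (hW.mem_nhds hw)).differentiableAt (by simp)

theorem dzbar_zComp_zero : dzbar (fun u => zComp F u 0) w =
    Complex.I * (star (dz ψ₂ w) * star (ψ₂ w) + dzbar ψ₁ w * ψ₁ w) := by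
  have h1 := hψ.differentiableAt₁ hW hw
  have h2 := hψ.differentiableAt₂ hW hw
  have h2' : DifferentiableAt ℝ (fun u => star (ψ₂ u)) w := h2.star
  rw [dzbar_congr (Filter.eventuallyEq_of_mem (hW.mem_nhds hw) hψ.z₁)]
  simp only [pow_two]
  rw [dzbar_const_mul _ ((h2'.fun_mul h2').fun_add (h1.fun_mul h1)),
    dzbar_add (h2'.fun_mul h2') (h1.fun_mul h1),
    dzbar_mul h2' h2', dzbar_mul h1 h1, dzbar_star h2]
  ring

theorem dzbar_zComp_one : dzbar (fun u => zComp F u 1) w =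
    star (dz ψ₂ w) * star (ψ₂ w) - dzbar ψ₁ w * ψ₁ w := by
  have h1 := hψ.differentiableAt₁ hW hw
  have h2 := hψ.differentiableAt₂ hW hw
  have h2' : DifferentiableAt ℝ (fun u => star (ψ₂ u)) w := h2.star
  rw [dzbar_congr (Filter.eventuallyEq_of_mem (hW.mem_nhds hw) hψ.z₂)]
  simp only [pow_two]
  rw [dzbar_const_mul _ ((h2'.fun_mul h2').fun_sub (h1.fun_mul h1)),
    dzbar_sub (h2'.fun_mul h2') (h1.fun_mul h1),
    dzbar_mul h2' h2', dzbar_mul h1 h1, dzbar_star h2]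
  ring

theorem dzbar_zComp_two : dzbar (fun u => zComp F u 2) w =
    dzbar ψ₁ w * star (ψ₂ w) + ψ₁ w * star (dz ψ₂ w) := by
  have h1 := hψ.differentiableAt₁ hW hw
  have h2 := hψ.differentiableAt₂ hW hw
  have h2' : DifferentiableAt ℝ (fun u => star (ψ₂ u)) w := h2.star
  rw [dzbar_congr (Filter.eventuallyEq_of_mem (hW.mem_nhds hw) hψ.z₃), dzbar_mul h1 h2',
    dzbar_star h2]

/-- With $a=\psi_2\partial\psi_2$ and $b=\psi_1\bar\partial\psi_1$, one has $\bar\partial Z_1=i(\bar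
a+b)$ and $\bar\partial Z_2=\bar a-b$. Both are real because the first two coframe forms are closed,
so $a+b$ has zero real and zero imaginary part. -/
theorem dz_mul_add_dzbar_mul (hF : SmoothNilOn F W) :
    dz ψ₂ w * ψ₂ w + dzbar ψ₁ w * ψ₁ w = 0 := by
  have h0 := congrArg Complex.im (hF.dzbar_zComp hW hw 0)
  have h1 := congrArg Complex.im (hF.dzbar_zComp hW hw 1)
  rw [hF.maurerCartan hW hw, hψ.dzbar_zComp_zero hW hw] at h0
  rw [hF.maurerCartan hW hw, hψ.dzbar_zComp_one hW hw] at h1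
  simp at h0 h1
  apply Complex.ext
  · simp; linarith
  · simp; linarith

/-- The preceding relation makes $(\bar\partial\psi_1,-\partial\psi_2)$ proportional to
$(\psi_2,\psi_1)$; `diracPotential` is the factor, found by Hermitian projection onto that vector.
-/
theorem dz_eq (hF : SmoothNilOn F W) (hS : 0 < spinorDensity (ψ₁ w) (ψ₂ w)) :
    dz ψ₂ w = -(diracPotential ψ₁ ψ₂ w * ψ₁ w) := by
  have h := hψ.dz_mul_add_dzbar_mul hW hw hF
  have hS' : (spinorDensity (ψ₁ w) (ψ₂ w) : ℂ) ≠ 0 := by exact_mod_cast hS.ne'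
  rw [diracPotential]
  field_simp
  rw [spinorDensity_coe]
  linear_combination star (ψ₂ w) * h

theorem dzbar_eq (hF : SmoothNilOn F W) (hS : 0 < spinorDensity (ψ₁ w) (ψ₂ w)) :
    dzbar ψ₁ w = diracPotential ψ₁ ψ₂ w * ψ₂ w := by
  have h := hψ.dz_mul_add_dzbar_mul hW hw hF
  have hS' : (spinorDensity (ψ₁ w) (ψ₂ w) : ℂ) ≠ 0 := by exact_mod_cast hS.ne'
  rw [diracPotential]
  field_simp
  rw [spinorDensity_coe]
  linear_combination star (ψ₁ w) * h

omit hW in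
theorem mcForm_one : mcForm F w 1 = ![-2 * ((ψ₁ w).re * (ψ₁ w).im - (ψ₂ w).re * (ψ₂ w).im),
    (ψ₂ w).re ^ 2 - (ψ₂ w).im ^ 2 - (ψ₁ w).re ^ 2 + (ψ₁ w).im ^ 2,
    2 * ((ψ₁ w).re * (ψ₂ w).re + (ψ₁ w).im * (ψ₂ w).im)] := by
  ext k
  rw [mcForm_one_eq]
  fin_cases k
  · simp [hψ.z₁ w hw, pow_two]; ring
  · simp [hψ.z₂ w hw, pow_two]; ring
  · simp [hψ.z₃ w hw]

omit hW in
theorem mcForm_I : mcForm F w Complex.I =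
    ![-((ψ₂ w).re ^ 2 - (ψ₂ w).im ^ 2 + (ψ₁ w).re ^ 2 - (ψ₁ w).im ^ 2),
    2 * ((ψ₁ w).re * (ψ₁ w).im + (ψ₂ w).re * (ψ₂ w).im),
    2 * ((ψ₁ w).re * (ψ₂ w).im - (ψ₁ w).im * (ψ₂ w).re)] := by
  ext k
  rw [mcForm_I_eq]
  fin_cases k
  · simp [hψ.z₁ w hw, pow_two]; ring
  · simp [hψ.z₂ w hw, pow_two]; ring
  · simp [hψ.z₃ w hw]; ring

omit hψ hW hw in
theorem spinorDensity_eq (a b : ℂ) :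
    spinorDensity a b = a.re ^ 2 + a.im ^ 2 + (b.re ^ 2 + b.im ^ 2) := by
  simp only [spinorDensity, ← Complex.normSq_eq_norm_sq, Complex.normSq_apply]
  ring

omit hW in
theorem firstForm_one_one : firstForm F w 1 1 = spinorDensity (ψ₁ w) (ψ₂ w) ^ 2 := by
  rw [firstForm, hψ.mcForm_one hw, spinorDensity_eq]
  simp [dotProduct, Fin.sum_univ_three]
  ring

omit hW in
theorem firstForm_I_I :
    firstForm F w Complex.I Complex.I = spinorDensity (ψ₁ w) (ψ₂ w) ^ 2 := by
  rw [firstForm, hψ.mcForm_I hw, spinorDensity_eq]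
  simp [dotProduct, Fin.sum_univ_three]
  ring

omit hW in
theorem firstForm_one_I : firstForm F w 1 Complex.I = 0 := by
  rw [firstForm, hψ.mcForm_one hw, hψ.mcForm_I hw]
  simp [dotProduct, Fin.sum_univ_three]
  ring

omit hW in
theorem crossProduct_mcForm : crossProduct (mcForm F w 1) (mcForm F w Complex.I) =
    spinorDensity (ψ₁ w) (ψ₂ w) •
      ![-2 * (ψ₁ w * ψ₂ w).im, -2 * (ψ₁ w * ψ₂ w).re, ‖ψ₂ w‖ ^ 2 - ‖ψ₁ w‖ ^ 2] := by
  rw [hψ.mcForm_one hw, hψ.mcForm_I hw, spinorDensity_eq]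
  simp only [← Complex.normSq_eq_norm_sq, Complex.normSq_apply]
  ext k
  fin_cases k <;> simp [cross_apply] <;> ring

omit hW in
theorem unitNormal_eq (hS : 0 < spinorDensity (ψ₁ w) (ψ₂ w)) :
    unitNormal F w = (spinorDensity (ψ₁ w) (ψ₂ w))⁻¹ •
      ![-2 * (ψ₁ w * ψ₂ w).im, -2 * (ψ₁ w * ψ₂ w).re, ‖ψ₂ w‖ ^ 2 - ‖ψ₁ w‖ ^ 2] := by
  -- The length of the cross product is the area element, which is the conformal factor $S^2$.
  have h : Real.sqrt (crossProduct (mcForm F w 1) (mcForm F w Complex.I) ⬝ᵥ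
      crossProduct (mcForm F w 1) (mcForm F w Complex.I)) = spinorDensity (ψ₁ w) (ψ₂ w) ^ 2 := by
    rw [Real.sqrt_eq_iff_mul_self_eq
      (by rw [dotProduct]; exact Finset.sum_nonneg fun i _ => mul_self_nonneg _) (by positivity),
      hψ.crossProduct_mcForm hw, spinorDensity_eq]
    simp only [← Complex.normSq_eq_norm_sq, Complex.normSq_apply]
    simp [dotProduct, Fin.sum_univ_three]
    ring
  simp only [unitNormal, h]
  rw [hψ.crossProduct_mcForm hw, smul_smul]
  congr 1
  field_simp

omit hψ in
-- The trace sees only the symmetrised connection: $\nabla_{e_2}e_3+\nabla_{e_3}e_2=e_1$ and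
-- $\nabla_{e_1}e_3+\nabla_{e_3}e_1=-e_2$, while $\nabla_{e_1}e_2$ and $\nabla_{e_2}e_1$ cancel.
theorem trace_covDeriv (hF : SmoothNilOn F W) : covDeriv F w 1 1 +
      covDeriv F w Complex.I Complex.I =
    ![4 * (dzbar (fun u => zComp F u 0) w).re +
        (mcForm F w 1 1 * mcForm F w 1 2 + mcForm F w Complex.I 1 * mcForm F w Complex.I 2),
      4 * (dzbar (fun u => zComp F u 1) w).re -
        (mcForm F w 1 0 * mcForm F w 1 2 + mcForm F w Complex.I 0 * mcForm F w Complex.I 2),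
      4 * (dzbar (fun u => zComp F u 2) w).re] := by
  have h (k : Fin 3) := congrArg Complex.re (hF.dzbar_zComp hW hw k)
  simp at h
  ext k
  fin_cases k <;>
  · simp [h, covDeriv, Fin.sum_univ_three, Nil.connection, Nil.structureConst, Nil.coord,
      Nil.basis, Matrix.mul_apply]
    ring

/-- By conformality the sum of $m_im_j$ over the two coordinate directions is
$S^2(\delta_{ij}-N_iN_j)$. The connection terms of the trace therefore cancel when paired with $N$,
and only the divergence terms, linear in $\mathrm{Re}\,P$, are left. -/
theorem re_diracPotential (hF : SmoothNilOn F W) (hS : 0 < spinorDensity (ψ₁ w) (ψ₂ w)) :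
    (diracPotential ψ₁ ψ₂ w).re = meanCurvature F w / 2 * spinorDensity (ψ₁ w) (ψ₂ w) := by
  have hH : 2 * meanCurvature F w * spinorDensity (ψ₁ w) (ψ₂ w) ^ 2 =
      (covDeriv F w 1 1 + covDeriv F w Complex.I Complex.I) ⬝ᵥ unitNormal F w := by
    simp only [meanCurvature, secondForm, hψ.firstForm_one_one hw, hψ.firstForm_I_I hw,
      hψ.firstForm_one_I hw, add_dotProduct]
    field_simp
    ring
  rw [hψ.unitNormal_eq hw hS, trace_covDeriv hW hw hF, hψ.mcForm_one hw, hψ.mcForm_I hw,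
    hψ.dzbar_zComp_zero hW hw, hψ.dzbar_zComp_one hW hw, hψ.dzbar_zComp_two hW hw,
    hψ.dz_eq hW hw hF hS, hψ.dzbar_eq hW hw hF hS] at hH
  have key : 2 * meanCurvature F w * spinorDensity (ψ₁ w) (ψ₂ w) ^ 3 =
      4 * (diracPotential ψ₁ ψ₂ w).re * spinorDensity (ψ₁ w) (ψ₂ w) ^ 2 := by
    have : 2 * meanCurvature F w * spinorDensity (ψ₁ w) (ψ₂ w) ^ 3 =
      spinorDensity (ψ₁ w) (ψ₂ w) *
        (2 * meanCurvature F w * spinorDensity (ψ₁ w) (ψ₂ w) ^ 2) := by ring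
    rw [this, hH, dotProduct_smul, smul_eq_mul, mul_inv_cancel_left₀ hS.ne', spinorDensity_eq]
    simp only [← Complex.normSq_eq_norm_sq, Complex.normSq_apply]
    simp [dotProduct, Fin.sum_univ_three]
    ring
  field_simp
  have h2 : spinorDensity (ψ₁ w) (ψ₂ w) ^ 2 ≠ 0 := by positivity
  apply mul_right_cancel₀ h2
  linarith

/-- Here the bracket $[e_1,e_2]=e_3$ enters: $4\,\mathrm{Im}\,\bar\partial Z_3$ is the signed area
of the projection to the $e_1,e_2$ plane, equal to $S(|\psi_2|^2-|\psi_1|^2)$, whereas the Dirac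
equation gives $\mathrm{Im}\,\bar\partial Z_3=S\,\mathrm{Im}\,P$. -/
theorem im_diracPotential (hF : SmoothNilOn F W) (hS : 0 < spinorDensity (ψ₁ w) (ψ₂ w)) :
    (diracPotential ψ₁ ψ₂ w).im = 1 / 4 * (‖ψ₂ w‖ ^ 2 - ‖ψ₁ w‖ ^ 2) := by
  have h0 := congrArg Complex.im (hF.dzbar_zComp hW hw 2)
  rw [hF.maurerCartan hW hw, hψ.dzbar_zComp_two hW hw, hψ.mcForm_one hw, hψ.mcForm_I hw,
    hψ.dz_eq hW hw hF hS, hψ.dzbar_eq hW hw hF hS] at h0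
  apply mul_left_cancel₀ hS.ne'
  rw [spinorDensity_eq]
  simp only [← Complex.normSq_eq_norm_sq, Complex.normSq_apply]
  simp [pow_two] at h0
  linarith

/-- The imaginary part of the energy density is an exact form. -/
theorem im_diracPotential_sq (hF : SmoothNilOn F W) (hS : 0 < spinorDensity (ψ₁ w) (ψ₂ w)) :
    (diracPotential ψ₁ ψ₂ w ^ 2).im = 1 / 2 * (dzbar (fun u => zComp F u 2) w).re := by
  have h := hψ.im_diracPotential hW hw hF hS
  -- Now $\mathrm{Re}\,\bar\partial
  -- Z_3=\mathrm{Re}\,P\,(|\psi_2|^2-|\psi_1|^2)=4\,\mathrm{Re}\,P\,\mathrm{Im}\,P$.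
  rw [hψ.dzbar_zComp_two hW hw, hψ.dz_eq hW hw hF hS, hψ.dzbar_eq hW hw hF hS]
  simp only [← Complex.normSq_eq_norm_sq, Complex.normSq_apply] at h
  simp [pow_two]
  rw [h]
  ring

theorem re_diracPotential_sq (hF : SmoothNilOn F W) (hS : 0 < spinorDensity (ψ₁ w) (ψ₂ w)) :
    (diracPotential ψ₁ ψ₂ w ^ 2).re =
      meanCurvature F w ^ 2 / 4 * (‖ψ₁ w‖ ^ 2 + ‖ψ₂ w‖ ^ 2) ^ 2 -
        1 / 16 * (‖ψ₂ w‖ ^ 2 - ‖ψ₁ w‖ ^ 2) ^ 2 := by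
  rw [pow_two, Complex.mul_re, hψ.re_diracPotential hW hw hF hS, hψ.im_diracPotential hW hw hF hS,
    spinorDensity]
  ring

end IsGeneratingSpinor

end Spinor

/-! ### Local existence of generating spinors. -/

section Existence

/-- A holomorphic branch of the square root near a nonzero complex number. -/
theorem Complex.exists_holomorphic_sqrt {c : ℂ} (hc : c ≠ 0) :
    ∃ (V : Set ℂ) (σ : ℂ → ℂ), IsOpen V ∧ c ∈ V ∧ DifferentiableOn ℂ σ V ∧
      ∀ u ∈ V, σ u ^ 2 = u ∧ σ u ≠ 0 := by
  -- Dividing by $c$ moves the centre to $1$, away from the cut of the principal logarithm.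
  refine ⟨(fun u => u / c) ⁻¹' Complex.slitPlane,
    fun u => Complex.exp (Complex.log c / 2) * Complex.exp (Complex.log (u / c) / 2),
    Complex.isOpen_slitPlane.preimage (by fun_prop), by simp [hc], ?_, fun u hu => ⟨?_, ?_⟩⟩
  · intro u hu
    have h1 : DifferentiableAt ℂ (fun u : ℂ => u / c) u := by fun_prop
    have h2 : DifferentiableAt ℂ (fun u => Complex.log (u / c)) u := h1.clog hu
    exact (((h2.div_const 2).cexp).const_mul _).differentiableWithinAt
  · have h1 : u / c ≠ 0 := Complex.slitPlane_ne_zero hu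
    beta_reduce
    rw [← Complex.exp_add, ← Complex.exp_nat_mul]
    have : ((2 : ℕ) : ℂ) * (Complex.log c / 2 + Complex.log (u / c) / 2) =
        Complex.log c + Complex.log (u / c) := by push_cast; ring
    rw [this, Complex.exp_add, Complex.exp_log hc, Complex.exp_log h1]
    field_simp
  · exact mul_ne_zero (Complex.exp_ne_zero _) (Complex.exp_ne_zero _)

/-- A smooth complex function has a smooth square root near a point where it does not vanish. -/
theorem ContDiffOn.exists_sqrt {g : ℂ → ℂ} {W : Set ℂ} {w : ℂ} (hg : ContDiffOn ℝ ∞ g W)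
    (hW : IsOpen W) (hw : w ∈ W) (h0 : g w ≠ 0) :
    ∃ (W' : Set ℂ) (s : ℂ → ℂ), IsOpen W' ∧ w ∈ W' ∧ W' ⊆ W ∧ ContDiffOn ℝ ∞ s W' ∧
      ∀ u ∈ W', s u ^ 2 = g u ∧ s u ≠ 0 := by
  obtain ⟨V, σ, hV, hcV, hσ, h⟩ := Complex.exists_holomorphic_sqrt h0
  refine ⟨W ∩ g ⁻¹' V, σ ∘ g, hg.continuousOn.isOpen_inter_preimage hW hV, ⟨hw, hcV⟩,
    Set.inter_subset_left, ?_, fun u hu => h _ hu.2⟩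
  exact ((hσ.contDiffOn hV).restrict_scalars ℝ).comp (hg.mono Set.inter_subset_left)
    fun u hu => hu.2

/-- A holomorphic function has a holomorphic square root near a point where it does not
vanish. -/
theorem DifferentiableOn.exists_sqrt {g : ℂ → ℂ} {W : Set ℂ} {w : ℂ} (hg : DifferentiableOn ℂ g W)
    (hW : IsOpen W) (hw : w ∈ W) (h0 : g w ≠ 0) :
    ∃ (W' : Set ℂ) (s : ℂ → ℂ), IsOpen W' ∧ w ∈ W' ∧ W' ⊆ W ∧ DifferentiableOn ℂ s W' ∧
      ∀ u ∈ W', s u ^ 2 = g u := by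
  obtain ⟨V, σ, hV, hcV, hσ, h⟩ := Complex.exists_holomorphic_sqrt h0
  refine ⟨W ∩ g ⁻¹' V, σ ∘ g, hg.continuousOn.isOpen_inter_preimage hW hV, ⟨hw, hcV⟩,
    Set.inter_subset_left, ?_, fun u hu => (h _ hu.2).1⟩
  exact hσ.comp (hg.mono Set.inter_subset_left) fun u hu => hu.2

/-- `F` is a smooth conformal immersion on `W`. -/
structure ConformalOn (F : ℂ → Nil) (W : Set ℂ) : Prop where
  smooth : SmoothNilOn F W
  pos : ∀ w ∈ W, 0 < firstForm F w 1 1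
  eq : ∀ w ∈ W, firstForm F w 1 1 = firstForm F w Complex.I Complex.I
  orth : ∀ w ∈ W, firstForm F w 1 Complex.I = 0

variable {F : ℂ → Nil} {W : Set ℂ} {w : ℂ}

theorem ConformalOn.mono (h : ConformalOn F W) {W' : Set ℂ} (hW : W' ⊆ W) : ConformalOn F W' :=
  ⟨h.smooth.mono hW, fun w hw => h.pos w (hW hw), fun w hw => h.eq w (hW hw),
    fun w hw => h.orth w (hW hw)⟩

/-- Four times the sum is $|F_x|^2-|F_y|^2-2i\langle F_x,F_y\rangle$. -/
theorem ConformalOn.sum_sq_zComp (h : ConformalOn F W) (hw : w ∈ W) :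
    zComp F w 0 ^ 2 + zComp F w 1 ^ 2 + zComp F w 2 ^ 2 = 0 := by
  have h1 := congrArg Complex.ofReal (h.eq w hw)
  have h2 := congrArg Complex.ofReal (h.orth w hw)
  simp [firstForm, dotProduct, Fin.sum_univ_three] at h1 h2
  simp only [zComp]
  linear_combination 1 / 4 * h1 - Complex.I / 2 * h2 + 1 / 4 *
    ((mcForm F w Complex.I 0 : ℂ) ^ 2 + (mcForm F w Complex.I 1 : ℂ) ^ 2 +
      (mcForm F w Complex.I 2 : ℂ) ^ 2) * Complex.I_sq

/-- A conformal immersion has generating spinors locally. -/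
theorem ConformalOn.exists_isGeneratingSpinor (h : ConformalOn F W) (hW : IsOpen W) (hw : w ∈ W) :
    ∃ (W' : Set ℂ) (ψ₁ ψ₂ : ℂ → ℂ), IsOpen W' ∧ w ∈ W' ∧ W' ⊆ W ∧
      IsGeneratingSpinor F W' ψ₁ ψ₂ := by
  have hZ (k : Fin 3) := h.smooth.contDiffOn_zComp hW k
  have hA : ContDiffOn ℝ ∞ (fun u => -Complex.I * zComp F u 0 - zComp F u 1) W :=
    (contDiffOn_const.mul (hZ 0)).sub (hZ 1)
  have hB : ContDiffOn ℝ ∞ (fun u => -Complex.I * zComp F u 0 + zComp F u 1) W :=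
    (contDiffOn_const.mul (hZ 0)).add (hZ 1)
  -- The null condition factors. The two factors have to be $\psi_1^2$ and $\bar\psi_2^2$, and $Z_3$
  -- their mixed product.
  have hAB (u : ℂ) (hu : u ∈ W) : (-Complex.I * zComp F u 0 - zComp F u 1) *
      (-Complex.I * zComp F u 0 + zComp F u 1) = zComp F u 2 ^ 2 := by
    linear_combination -h.sum_sq_zComp hu + zComp F u 0 ^ 2 * Complex.I_sq
  have hstar {s : ℂ → ℂ} {W : Set ℂ} (hs : ContDiffOn ℝ ∞ s W) :
      ContDiffOn ℝ ∞ (fun u => star (s u)) W := by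
    exact (Complex.conjCLE : ℂ →L[ℝ] ℂ).contDiff.comp_contDiffOn hs
  -- An immersion excludes that both factors vanish at `w`. A root is taken of a nonvanishing one,
  -- and the other component is $Z_3$ divided by it, which also fixes the relative sign.
  by_cases h0 : -Complex.I * zComp F w 0 - zComp F w 1 = 0
  · have h1 : -Complex.I * zComp F w 0 + zComp F w 1 ≠ 0 := by
      intro h1
      have e0 : zComp F w 0 = 0 := by
        linear_combination Complex.I / 2 * (h0 + h1) + zComp F w 0 * Complex.I_sq
      have e1 : zComp F w 1 = 0 := by linear_combination (h1 - h0) / 2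
      have e2 : zComp F w 2 = 0 := by
        have := hAB w hw
        rw [h0, zero_mul] at this
        exact pow_eq_zero_iff (two_ne_zero) |>.1 this.symm
      have := h.pos w hw
      simp [firstForm, dotProduct, Fin.sum_univ_three, mcForm_one_eq, e0, e1, e2] at this
    obtain ⟨W', s, hW', hw', hsub, hs, hsq⟩ := hB.exists_sqrt hW hw h1
    refine ⟨W', fun u => zComp F u 2 / s u, fun u => star (s u), hW', hw', hsub,
      ((hZ 2).mono hsub).mul (hs.inv fun u hu => (hsq u hu).2), hstar hs, ?_, ?_, ?_⟩
    all_goals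
      intro u hu
      have h2 := hAB u (hsub hu)
      obtain ⟨h3, h4⟩ := hsq u hu
      simp only [star_star]
      rw [← h3] at h2
      have h5 : (zComp F u 2 / s u) ^ 2 = -Complex.I * zComp F u 0 - zComp F u 1 := by
        field_simp
        linear_combination -h2
    · rw [h5, h3]; linear_combination zComp F u 0 * Complex.I_sq
    · rw [h5, h3]; ring
    · field_simp
  · obtain ⟨W', s, hW', hw', hsub, hs, hsq⟩ := hA.exists_sqrt hW hw h0
    refine ⟨W', s, fun u => star (zComp F u 2 / s u), hW', hw', hsub, hs,
      hstar (((hZ 2).mono hsub).mul (hs.inv fun u hu => (hsq u hu).2)), ?_, ?_, ?_⟩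
    all_goals
      intro u hu
      have h2 := hAB u (hsub hu)
      obtain ⟨h3, h4⟩ := hsq u hu
      simp only [star_star]
      rw [← h3] at h2
      have h5 : (zComp F u 2 / s u) ^ 2 = -Complex.I * zComp F u 0 + zComp F u 1 := by
        field_simp
        linear_combination -h2
    · rw [h5, h3]; linear_combination zComp F u 0 * Complex.I_sq
    · rw [h5, h3]; ring
    · field_simp

end Existence

/-! ### Uniqueness of the potentials and independence of the spinor. -/

namespace IsGeneratingSpinor

variable {F : ℂ → Nil} {W : Set ℂ} {ψ₁ ψ₂ : ℂ → ℂ} {w : ℂ}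

theorem spinorDensity_pos (hψ : IsGeneratingSpinor F W ψ₁ ψ₂) (hF : ConformalOn F W)
    (hw : w ∈ W) : 0 < spinorDensity (ψ₁ w) (ψ₂ w) := by
  have h := hF.pos w hw
  rw [hψ.firstForm_one_one hw] at h
  refine lt_of_le_of_ne ?_ fun h' => ?_
  · rw [spinorDensity]; positivity
  · simp [← h'] at h

theorem continuousOn_diracPotential (hψ : IsGeneratingSpinor F W ψ₁ ψ₂) (hW : IsOpen W)
    (hF : ConformalOn F W) : ContinuousOn (diracPotential ψ₁ ψ₂) W := by
  have h1 := hψ.smooth₁.continuousOn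
  have h2 := hψ.smooth₂.continuousOn
  have h3 : ContinuousOn (fun w => (spinorDensity (ψ₁ w) (ψ₂ w) : ℂ)) W := by
    simp only [spinorDensity_coe]
    exact (h1.mul h1.star).add (h2.mul h2.star)
  exact (((hψ.smooth₁.continuousOn_dzbar hW).mul h2.star).sub
    ((hψ.smooth₂.continuousOn_dz hW).mul h1.star)).div h3 fun w hw => by
      exact_mod_cast (hψ.spinorDensity_pos hF hw).ne'

theorem isDiracPotential (hψ : IsGeneratingSpinor F W ψ₁ ψ₂) (hW : IsOpen W)
    (hF : ConformalOn F W) :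
    IsDiracPotential W ψ₁ ψ₂ (diracPotential ψ₁ ψ₂) (diracPotential ψ₁ ψ₂) where
  continuous_U := hψ.continuousOn_diracPotential hW hF
  continuous_V := hψ.continuousOn_diracPotential hW hF
  dirac₁ w hw := by
    rw [hψ.dz_eq hW hw hF.smooth (hψ.spinorDensity_pos hF hw)]; ring
  dirac₂ w hw := by
    rw [hψ.dzbar_eq hW hw hF.smooth (hψ.spinorDensity_pos hF hw)]; ring

/-- The first component of a spinor does not vanish identically near any point. -/
theorem frequently_ne_zero (hψ : IsGeneratingSpinor F W ψ₁ ψ₂) (hW : IsOpen W)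
    (hF : ConformalOn F W) (hw : w ∈ W) : ∃ᶠ u in nhds w, ψ₁ u ≠ 0 := by
  intro h
  have h1 : ψ₁ =ᶠ[nhds w] fun _ => 0 := h.mono fun u hu => not_not.1 hu
  have hS := hψ.spinorDensity_pos hF hw
  have h2 := hψ.dzbar_eq hW hw hF.smooth hS
  have h3 : dzbar ψ₁ w = 0 := by rw [dzbar_congr h1]; simp [dzbar]
  have h4 : ψ₁ w = 0 := h1.self_of_nhds
  have h5 : ψ₂ w ≠ 0 := fun h5 => by simp [h4, h5, spinorDensity] at hS
  have h6 : diracPotential ψ₁ ψ₂ w = 0 := by simpa [h3, h5] using h2.symm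
  -- The Dirac equation forces the potential to be zero, but its imaginary part would be
  -- $|\psi_2|^2/4\ne0$.
  have h7 := hψ.im_diracPotential hW hw hF.smooth hS
  simp [h4, h6, h5] at h7

/-- The same for the second component. -/
theorem frequently_ne_zero' (hψ : IsGeneratingSpinor F W ψ₁ ψ₂) (hW : IsOpen W)
    (hF : ConformalOn F W) (hw : w ∈ W) : ∃ᶠ u in nhds w, ψ₂ u ≠ 0 := by
  intro h
  have h1 : ψ₂ =ᶠ[nhds w] fun _ => 0 := h.mono fun u hu => not_not.1 hu
  have hS := hψ.spinorDensity_pos hF hw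
  have h2 := hψ.dz_eq hW hw hF.smooth hS
  have h3 : dz ψ₂ w = 0 := by rw [dz_congr h1]; simp [dz]
  have h4 : ψ₂ w = 0 := h1.self_of_nhds
  have h5 : ψ₁ w ≠ 0 := fun h5 => by simp [h4, h5, spinorDensity] at hS
  have h6 : diracPotential ψ₁ ψ₂ w = 0 := by simpa [h3, h5] using h2.symm
  have h7 := hψ.im_diracPotential hW hw hF.smooth hS
  simp [h4, h6, h5] at h7

/-- Continuous functions that agree frequently near a point agree at the point. -/
theorem _root_.ContinuousAt.eq_of_frequently_eq {X Y : Type*} [TopologicalSpace X]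
    [TopologicalSpace Y] [T2Space Y] {g h : X → Y} {x : X} (hg : ContinuousAt g x)
    (hh : ContinuousAt h x) (he : ∃ᶠ u in nhds x, g u = h u) : g x = h x := by
  by_contra hne
  exact he ((hg.prodMk hh).preimage_mem_nhds (isClosed_diagonal.isOpen_compl.mem_nhds hne))

/-- The potentials of a Dirac operator that annihilates the spinor are unique. -/
theorem eq_diracPotential (hψ : IsGeneratingSpinor F W ψ₁ ψ₂) (hW : IsOpen W)
    (hF : ConformalOn F W) (hw : w ∈ W) {U V : ℂ → ℂ} (hUV : IsDiracPotential W ψ₁ ψ₂ U V) :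
    U w = diracPotential ψ₁ ψ₂ w ∧ V w = diracPotential ψ₁ ψ₂ w := by
  have hc := (hψ.continuousOn_diracPotential hW hF).continuousAt (hW.mem_nhds hw)
  have hd := hψ.isDiracPotential hW hF
  constructor
  -- The first Dirac equation determines `U` only where $\psi_1\ne0$. Such points accumulate at `w`,
  -- and continuity gives the value there.
  · refine (hUV.continuous_U.continuousAt (hW.mem_nhds hw)).eq_of_frequently_eq hc ?_
    refine ((hψ.frequently_ne_zero hW hF hw).and_eventually (hW.mem_nhds hw)).mono ?_
    rintro u ⟨hu, huW⟩
    apply mul_right_cancel₀ hu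
    linear_combination hUV.dirac₁ u huW - hd.dirac₁ u huW
  · refine (hUV.continuous_V.continuousAt (hW.mem_nhds hw)).eq_of_frequently_eq hc ?_
    refine ((hψ.frequently_ne_zero' hW hF hw).and_eventually (hW.mem_nhds hw)).mono ?_
    rintro u ⟨hu, huW⟩
    apply mul_right_cancel₀ hu
    linear_combination hUV.dirac₂ u huW - hd.dirac₂ u huW

/-- $\psi_1^2=-iZ_1-Z_2$, so the modulus depends on `F` alone; this replaces uniqueness of the
spinor up to sign. -/
theorem norm_sq₁ (hψ : IsGeneratingSpinor F W ψ₁ ψ₂) (hw : w ∈ W) :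
    ‖ψ₁ w‖ ^ 2 = ‖-Complex.I * zComp F w 0 - zComp F w 1‖ := by
  rw [← norm_pow, hψ.z₁ w hw, hψ.z₂ w hw]
  congr 1
  linear_combination 1 / 2 * (star (ψ₂ w) ^ 2 + ψ₁ w ^ 2) * Complex.I_sq

theorem norm_sq₂ (hψ : IsGeneratingSpinor F W ψ₁ ψ₂) (hw : w ∈ W) :
    ‖ψ₂ w‖ ^ 2 = ‖-Complex.I * zComp F w 0 + zComp F w 1‖ := by
  rw [← norm_star, ← norm_pow, hψ.z₁ w hw, hψ.z₂ w hw]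
  congr 1
  linear_combination 1 / 2 * (star (ψ₂ w) ^ 2 + ψ₁ w ^ 2) * Complex.I_sq

/-- The square of the potential depends only on the surface. -/
theorem diracPotential_sq_eq {W' : Set ℂ} {χ₁ χ₂ : ℂ → ℂ} (hψ : IsGeneratingSpinor F W ψ₁ ψ₂)
    (hW : IsOpen W) (hF : ConformalOn F W) (hw : w ∈ W) (hχ : IsGeneratingSpinor F W' χ₁ χ₂)
    (hW' : IsOpen W') (hF' : ConformalOn F W') (hw' : w ∈ W') :
    diracPotential ψ₁ ψ₂ w ^ 2 = diracPotential χ₁ χ₂ w ^ 2 := by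
  have hS := hψ.spinorDensity_pos hF hw
  have hS' := hχ.spinorDensity_pos hF' hw'
  -- The real part is a function of $H$ and the moduli, the imaginary part of $\bar\partial Z_3$;
  -- none of these sees the spinor.
  apply Complex.ext
  · rw [hψ.re_diracPotential_sq hW hw hF.smooth hS, hχ.re_diracPotential_sq hW' hw' hF'.smooth hS',
      hψ.norm_sq₁ hw, hψ.norm_sq₂ hw, hχ.norm_sq₁ hw', hχ.norm_sq₂ hw']
  · rw [hψ.im_diracPotential_sq hW hw hF.smooth hS, hχ.im_diracPotential_sq hW' hw' hF'.smooth hS']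

end IsGeneratingSpinor

/-- Change of the conformal parameter: `mcForm` of the composition with a holomorphic map. -/
theorem zComp_comp {F G : ℂ → Nil} {τ : ℂ → ℂ} {W : Set ℂ} {w : ℂ} (hF : SmoothNilOn F W)
    (hW : IsOpen W) (hw : τ w ∈ W) (hτ : DifferentiableAt ℂ τ w)
    (hG : G =ᶠ[nhds w] F ∘ τ) (k : Fin 3) :
    zComp G w k = zComp F (τ w) k * deriv τ w := by
  have key (c : Nil → ℝ) (hc : ContDiffOn ℝ ∞ (fun u => c (F u)) W) (v : ℂ) :
      fderiv ℝ (fun u => c (G u)) w v =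
        fderiv ℝ (fun u => c (F u)) (τ w) (deriv τ w * v) := by
    have h1 : (fun u => c (G u)) =ᶠ[nhds w] (fun u => c (F u)) ∘ τ := hG.fun_comp c
    have h2 := (hc.contDiffAt (hW.mem_nhds hw)).differentiableAt (by simp)
    rw [h1.fderiv_eq, fderiv_comp w h2 (hτ.restrictScalars ℝ), ContinuousLinearMap.comp_apply,
      fderiv_real_apply hτ]
  have hm (v : ℂ) : mcForm G w v = mcForm F (τ w) (deriv τ w * v) := by
    rw [mcForm_eq, mcForm_eq, key Nil.x hF.x, key Nil.y hF.y, key Nil.z hF.z, hG.self_of_nhds]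
    rfl
  -- Real linearity in the direction, applied below to $\tau'$ and $i\tau'$.
  have hl (v : ℂ) : mcForm F (τ w) v k = v.re * mcForm F (τ w) 1 k +
      v.im * mcForm F (τ w) Complex.I k := by
    have hv : v = v.re • (1 : ℂ) + v.im • Complex.I := by simp
    have hL (L : ℂ →L[ℝ] ℝ) : L v = v.re * L 1 + v.im * L Complex.I := by
      conv_lhs => rw [hv]
      simp only [map_add, map_smul, smul_eq_mul]
    simp only [mcForm_eq]
    fin_cases k
    · simpa using hL _
    · simpa using hL _
    · simp only [Fin.reduceFinMk, Matrix.cons_val]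
      rw [hL (fderiv ℝ (fun u => (F u).z) (τ w)), hL (fderiv ℝ (fun u => (F u).y) (τ w))]
      ring
  simp only [zComp, hm]
  rw [hl (deriv τ w * 1), hl (deriv τ w * Complex.I)]
  have hd := (Complex.re_add_im (deriv τ w)).symm
  simp only [mul_one, Complex.mul_I_re, Complex.mul_I_im]
  conv_rhs => rw [hd]
  push_cast
  linear_combination (deriv τ w).im * mcForm F (τ w) Complex.I k / 2 * Complex.I_sq

/-! ### The smooth structure underlying the Riemann surface. -/

section RealStructure

variable {M : Type*} [TopologicalSpace M] [ChartedSpace ℂ M]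

theorem contDiffOn_transition {φ χ : OpenPartialHomeomorph M ℂ}
    (hφ : φ ∈ IsManifold.maximalAtlas 𝓘(ℂ) ω M) (hχ : χ ∈ IsManifold.maximalAtlas 𝓘(ℂ) ω M) :
    ContDiffOn ℂ ω (χ ∘ φ.symm) (φ.symm.trans χ).source :=
  (contMDiffOn_of_mem_contDiffGroupoid
    (IsManifold.compatible_of_mem_maximalAtlas hφ hχ)).contDiffOn

theorem differentiableAt_transition {φ χ : OpenPartialHomeomorph M ℂ}
    (hφ : φ ∈ IsManifold.maximalAtlas 𝓘(ℂ) ω M) (hχ : χ ∈ IsManifold.maximalAtlas 𝓘(ℂ) ω M)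
    {w : ℂ} (hw : w ∈ (φ.symm.trans χ).source) : DifferentiableAt ℂ (χ ∘ φ.symm) w :=
  ((contDiffOn_transition hφ hχ).contDiffAt
    ((φ.symm.trans χ).open_source.mem_nhds hw)).differentiableAt (by simp)

/-- Holomorphic transition maps are smooth. -/
theorem mem_contDiffGroupoid_real {e : OpenPartialHomeomorph ℂ ℂ}
    (he : e ∈ contDiffGroupoid ω 𝓘(ℂ)) : e ∈ contDiffGroupoid ∞ 𝓘(ℝ, ℂ) := by
  have h1 := (contMDiffOn_of_mem_contDiffGroupoid he).contDiffOn
  have h2 := (contMDiffOn_of_mem_contDiffGroupoid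
    ((contDiffGroupoid ω 𝓘(ℂ)).symm he)).contDiffOn
  rw [contDiffGroupoid, mem_groupoid_of_pregroupoid]
  exact ⟨by simpa [contDiffPregroupoid] using (h1.restrict_scalars ℝ).of_le (by simp),
    by simpa [contDiffPregroupoid] using (h2.restrict_scalars ℝ).of_le (by simp)⟩

theorem mem_maximalAtlas_real {φ : OpenPartialHomeomorph M ℂ}
    (hφ : φ ∈ IsManifold.maximalAtlas 𝓘(ℂ) ω M) : φ ∈ IsManifold.maximalAtlas 𝓘(ℝ, ℂ) ∞ M := by
  rw [IsManifold.mem_maximalAtlas_iff, mem_maximalAtlas_iff] at hφ ⊢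
  exact fun e he => ⟨mem_contDiffGroupoid_real (hφ e he).1, mem_contDiffGroupoid_real (hφ e he).2⟩

variable (M) in
/-- The smooth manifold underlying a Riemann surface. -/
theorem isManifold_real [IsManifold 𝓘(ℂ) ω M] : IsManifold 𝓘(ℝ, ℂ) ∞ M where
  compatible he he' := mem_contDiffGroupoid_real (HasGroupoid.compatible he he')

/-- A smooth function on a Riemann surface is smooth in every holomorphic chart. -/
theorem ContMDiff.contDiffOn_comp_symm {g : M → ℝ} (hg : ContMDiff 𝓘(ℝ, ℂ) 𝓘(ℝ, ℝ) ∞ g)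
    {φ : OpenPartialHomeomorph M ℂ} (hφ : φ ∈ IsManifold.maximalAtlas 𝓘(ℂ) ω M) :
    ContDiffOn ℝ ∞ (g ∘ φ.symm) φ.target :=
  (hg.comp_contMDiffOn
    (contMDiffOn_symm_of_mem_maximalAtlas (mem_maximalAtlas_real hφ))).contDiffOn

theorem IsConformalImmersion.conformalOn {f : M → Nil} (hf : IsConformalImmersion f)
    {φ : OpenPartialHomeomorph M ℂ} (hφ : φ ∈ IsManifold.maximalAtlas 𝓘(ℂ) ω M) :
    ConformalOn (f ∘ φ.symm) φ.target where
  smooth := ⟨hf.smooth_x.contDiffOn_comp_symm hφ, hf.smooth_y.contDiffOn_comp_symm hφ,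
    hf.smooth_z.contDiffOn_comp_symm hφ⟩
  pos w hw := (hf.conformal φ hφ w hw).1
  eq w hw := (hf.conformal φ hφ w hw).2.1
  orth w hw := (hf.conformal φ hφ w hw).2.2

end RealStructure

theorem eventuallyEq_comp_transition {M : Type*} [TopologicalSpace M] (f : M → Nil) {φ χ : OpenPartialHomeomorph M ℂ} {w : ℂ}
    (hw : w ∈ (φ.symm.trans χ).source) :
    f ∘ φ.symm =ᶠ[nhds w] (f ∘ χ.symm) ∘ (χ ∘ φ.symm) := by
  filter_upwards [(φ.symm.trans χ).open_source.mem_nhds hw] with u hu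
  simp only [OpenPartialHomeomorph.trans_source, Set.mem_inter_iff, Set.mem_preimage] at hu
  simp [χ.left_inv hu.2]

/-! ### The energy coefficient as a 2-form. -/

section EnergyForm

variable {M : Type*} [TopologicalSpace M] [ChartedSpace ℂ M]
  {f : M → Nil} {φ : OpenPartialHomeomorph M ℂ}

namespace IsConformalImmersion

variable (hf : IsConformalImmersion f) (hφ : φ ∈ IsManifold.maximalAtlas 𝓘(ℂ) ω M)
include hf hφ

/-- Replaces all choices of spinor and potentials by one fixed spinor, so that `energyCoeff` has a
local closed formula. -/
theorem isEnergyCoeff_iff {W : Set ℂ} {ψ₁ ψ₂ : ℂ → ℂ} (hW : IsOpen W) (hWφ : W ⊆ φ.target)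
    (hψ : IsGeneratingSpinor (f ∘ φ.symm) W ψ₁ ψ₂) {w : ℂ} (hw : w ∈ W) (c : ℂ) :
    IsEnergyCoeff f φ w c ↔ c = diracPotential ψ₁ ψ₂ w ^ 2 := by
  have hF := hf.conformalOn hφ
  constructor
  · rintro ⟨W', χ₁, χ₂, U, V, hW', hw', hWφ', hχ, hUV, rfl⟩
    obtain ⟨hU, hV⟩ := hχ.eq_diracPotential hW' (hF.mono hWφ') hw' hUV
    rw [hU, hV, ← pow_two]
    exact hχ.diracPotential_sq_eq hW' (hF.mono hWφ') hw' hψ hW (hF.mono hWφ) hw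
  · rintro rfl
    exact ⟨W, ψ₁, ψ₂, _, _, hW, hw, hWφ, hψ, hψ.isDiracPotential hW (hF.mono hWφ), pow_two _⟩

theorem existsUnique_isEnergyCoeff {w : ℂ} (hw : w ∈ φ.target) :
    ∃! c, IsEnergyCoeff f φ w c := by
  obtain ⟨W, ψ₁, ψ₂, hW, hwW, hWφ, hψ⟩ :=
    (hf.conformalOn hφ).exists_isGeneratingSpinor φ.open_target hw
  simp only [hf.isEnergyCoeff_iff hφ hW hWφ hψ hwW]
  exact existsUnique_eq

theorem energyCoeff_eq {W : Set ℂ} {ψ₁ ψ₂ : ℂ → ℂ} (hW : IsOpen W) (hWφ : W ⊆ φ.target)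
    (hψ : IsGeneratingSpinor (f ∘ φ.symm) W ψ₁ ψ₂) {w : ℂ} (hw : w ∈ W) :
    energyCoeff f φ w = diracPotential ψ₁ ψ₂ w ^ 2 :=
  (hf.isEnergyCoeff_iff hφ hW hWφ hψ hw _).1
    (Classical.epsilon_spec (hf.existsUnique_isEnergyCoeff hφ (hWφ hw)).exists)

theorem continuousOn_energyCoeff : ContinuousOn (energyCoeff f φ) φ.target := by
  intro w hw
  obtain ⟨W, ψ₁, ψ₂, hW, hwW, hWφ, hψ⟩ :=
    (hf.conformalOn hφ).exists_isGeneratingSpinor φ.open_target hw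
  have h := ((hψ.continuousOn_diracPotential hW ((hf.conformalOn hφ).mono hWφ)).pow 2).congr
    fun u hu => hf.energyCoeff_eq hφ hW hWφ hψ hu
  exact (h.continuousAt (hW.mem_nhds hwW)).continuousWithinAt

theorem im_energyCoeff {w : ℂ} (hw : w ∈ φ.target) :
    (energyCoeff f φ w).im = 1 / 2 * (dzbar (fun u => zComp (f ∘ φ.symm) u 2) w).re := by
  obtain ⟨W, ψ₁, ψ₂, hW, hwW, hWφ, hψ⟩ :=
    (hf.conformalOn hφ).exists_isGeneratingSpinor φ.open_target hw
  have hF := (hf.conformalOn hφ).mono hWφ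
  rw [hf.energyCoeff_eq hφ hW hWφ hψ hwW,
    hψ.im_diracPotential_sq hW hwW hF.smooth (hψ.spinorDensity_pos hF hwW)]

theorem re_energyCoeff {w : ℂ} (hw : w ∈ φ.target) :
    (energyCoeff f φ w).re = meanCurvature (f ∘ φ.symm) w ^ 2 / 4 *
        (‖(spinorAt f φ w).1‖ ^ 2 + ‖(spinorAt f φ w).2‖ ^ 2) ^ 2 -
      1 / 16 * (‖(spinorAt f φ w).2‖ ^ 2 - ‖(spinorAt f φ w).1‖ ^ 2) ^ 2 := by
  have h : ∃ s : ℂ × ℂ, ∃ (W : Set ℂ) (ψ₁ ψ₂ : ℂ → ℂ), IsOpen W ∧ w ∈ W ∧ W ⊆ φ.target ∧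
      IsGeneratingSpinor (f ∘ φ.symm) W ψ₁ ψ₂ ∧ s = (ψ₁ w, ψ₂ w) := by
    obtain ⟨W, ψ₁, ψ₂, hW, hwW, hWφ, hψ⟩ :=
      (hf.conformalOn hφ).exists_isGeneratingSpinor φ.open_target hw
    exact ⟨_, W, ψ₁, ψ₂, hW, hwW, hWφ, hψ, rfl⟩
  -- The spinor behind the chosen value `spinorAt` is also used to compute `energyCoeff`, so no two
  -- spinors need comparing.
  obtain ⟨W, ψ₁, ψ₂, hW, hwW, hWφ, hψ, hs⟩ := Classical.epsilon_spec h
  have hs' : spinorAt f φ w = (ψ₁ w, ψ₂ w) := hs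
  have hF := (hf.conformalOn hφ).mono hWφ
  rw [hf.energyCoeff_eq hφ hW hWφ hψ hwW, hs',
    hψ.re_diracPotential_sq hW hwW hF.smooth (hψ.spinorDensity_pos hF hwW)]

end IsConformalImmersion

theorem IsConformalImmersion.zComp_transition (hf : IsConformalImmersion f)
    {φ χ : OpenPartialHomeomorph M ℂ} (hφ : φ ∈ IsManifold.maximalAtlas 𝓘(ℂ) ω M)
    (hχ : χ ∈ IsManifold.maximalAtlas 𝓘(ℂ) ω M) {w : ℂ} (hw : w ∈ (φ.symm.trans χ).source)
    (k : Fin 3) : zComp (f ∘ φ.symm) w k =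
      zComp (f ∘ χ.symm) ((χ ∘ φ.symm) w) k * deriv (χ ∘ φ.symm) w :=
  zComp_comp (hf.conformalOn hχ).smooth χ.open_target (χ.map_source hw.2)
    (differentiableAt_transition hφ hχ hw) (eventuallyEq_comp_transition f hw) k

theorem deriv_transition_ne_zero {φ χ : OpenPartialHomeomorph M ℂ}
    (hφ : φ ∈ IsManifold.maximalAtlas 𝓘(ℂ) ω M) (hχ : χ ∈ IsManifold.maximalAtlas 𝓘(ℂ) ω M)
    {w : ℂ} (hw : w ∈ (φ.symm.trans χ).source) : deriv (χ ∘ φ.symm) w ≠ 0 := by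
  have h2 := differentiableAt_transition hφ hχ hw
  have hw' : (χ ∘ φ.symm) w ∈ (χ.symm.trans φ).source :=
    ⟨χ.map_source hw.2, by
      simpa [χ.left_inv (show φ.symm w ∈ χ.source from hw.2)] using φ.map_target hw.1⟩
  have h1 := differentiableAt_transition hχ hφ hw'
  have h3 : (φ ∘ χ.symm) ∘ (χ ∘ φ.symm) =ᶠ[nhds w] id := by
    filter_upwards [(φ.symm.trans χ).open_source.mem_nhds hw] with u hu
    simp only [OpenPartialHomeomorph.trans_source, Set.mem_inter_iff, Set.mem_preimage] at hu
    simp [χ.left_inv hu.2, φ.right_inv hu.1]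
  have h4 := h3.deriv_eq
  rw [deriv_comp w h1 h2] at h4
  intro h0
  simp [h0] at h4

/-- Spinors change as half-forms: for a holomorphic root $s^2=\tau'$ the pair $(s\,\psi_1\circ\tau,\
\bar s\,\psi_2\circ\tau)$ generates the surface in the other parameter. As $\bar\partial
s=\partial\bar s=0$, no derivative of $s$ enters the potential, which is multiplied by
$|s|^2=|\tau'|$. -/
theorem IsConformalImmersion.energyCoeff_transition (hf : IsConformalImmersion f)
    {φ χ : OpenPartialHomeomorph M ℂ} (hφ : φ ∈ IsManifold.maximalAtlas 𝓘(ℂ) ω M)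
    (hχ : χ ∈ IsManifold.maximalAtlas 𝓘(ℂ) ω M) {w : ℂ} (hw : w ∈ (φ.symm.trans χ).source) :
    energyCoeff f φ w =
      (‖deriv (χ ∘ φ.symm) w‖ : ℂ) ^ 2 * energyCoeff f χ ((χ ∘ φ.symm) w) := by
  set τ := χ ∘ φ.symm with hτdef
  have hopen := (φ.symm.trans χ).open_source
  have hτ : DifferentiableOn ℂ τ (φ.symm.trans χ).source := fun u hu =>
    (differentiableAt_transition hφ hχ hu).differentiableWithinAt
  obtain ⟨W', χ₁, χ₂, hW', hwW', hWχ, hψ'⟩ :=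
    (hf.conformalOn hχ).exists_isGeneratingSpinor χ.open_target
      (show τ w ∈ χ.target from χ.map_source hw.2)
  obtain ⟨W₁, s, hW₁, hwW₁, hsub, hs, hsq⟩ :=
    (hτ.deriv hopen).exists_sqrt hopen hw (deriv_transition_ne_zero hφ hχ hw)
  set W := W₁ ∩ τ ⁻¹' W' with hWdef
  have hW : IsOpen W := (hτ.mono hsub).continuousOn.isOpen_inter_preimage hW₁ hW'
  have hwW : w ∈ W := ⟨hwW₁, hwW'⟩
  have hWφ : W ⊆ φ.target := fun u hu => (hsub hu.1).1
  have hs' : ContDiffOn ℝ ∞ s W := ((hs.contDiffOn hW₁).restrict_scalars ℝ).mono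
    Set.inter_subset_left
  have hτ' : ContDiffOn ℝ ∞ τ W := ((hτ.contDiffOn hopen).restrict_scalars ℝ).mono
    fun u hu => hsub hu.1
  have hstar : ContDiffOn ℝ ∞ (fun u => star (s u)) W :=
    (Complex.conjCLE : ℂ →L[ℝ] ℂ).contDiff.comp_contDiffOn hs'
  have hZ {u : ℂ} (hu : u ∈ W) (k : Fin 3) : zComp (f ∘ φ.symm) u k =
      zComp (f ∘ χ.symm) (τ u) k * s u ^ 2 := by
    rw [hf.zComp_transition hφ hχ (hsub hu.1), hsq u hu.1]
  have hψ : IsGeneratingSpinor (f ∘ φ.symm) W (fun u => χ₁ (τ u) * s u)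
      (fun u => χ₂ (τ u) * star (s u)) := by
    refine ⟨(hψ'.smooth₁.comp hτ' fun u hu => hu.2).mul hs',
      (hψ'.smooth₂.comp hτ' fun u hu => hu.2).mul hstar, fun u hu => ?_, fun u hu => ?_,
      fun u hu => ?_⟩
    · rw [hZ hu, hψ'.z₁ _ hu.2]; simp only [star_mul', star_star]; ring
    · rw [hZ hu, hψ'.z₂ _ hu.2]; simp only [star_mul', star_star]; ring
    · rw [hZ hu, hψ'.z₃ _ hu.2]; simp only [star_mul', star_star]; ring
  have hs0 : s w ≠ 0 := by
    intro h0
    apply deriv_transition_ne_zero hφ hχ hw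
    rw [← hτdef, ← hsq w hwW₁, h0, zero_pow two_ne_zero]
  have hpot : diracPotential (fun u => χ₁ (τ u) * s u) (fun u => χ₂ (τ u) * star (s u)) w =
      diracPotential χ₁ χ₂ (τ w) * (s w * star (s w)) := by
    have hsd := (hs.differentiableAt (hW₁.mem_nhds hwW₁))
    have hsr := hsd.restrictScalars ℝ
    have hτd := (hτ.differentiableAt (hopen.mem_nhds hw))
    have hτr := hτd.restrictScalars ℝ
    have d1 := hψ'.differentiableAt₁ hW' hwW'
    have d2 := hψ'.differentiableAt₂ hW' hwW'
    rw [diracPotential, diracPotential, spinorDensity_coe, spinorDensity_coe,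
      dzbar_mul (g := fun u => χ₁ (τ u)) (d1.comp w hτr) hsr,
      dz_mul (g := fun u => χ₂ (τ u)) (d2.comp w hτr) hsr.star,
      dzbar_comp d1 hτd, dz_comp d2 hτd, dzbar_of_differentiableAt hsd, dz_star hsr,
      dzbar_of_differentiableAt hsd, ← hsq w hwW₁]
    have hS := hψ'.spinorDensity_pos ((hf.conformalOn hχ).mono hWχ) hwW'
    have hS' : χ₁ (τ w) * star (χ₁ (τ w)) + χ₂ (τ w) * star (χ₂ (τ w)) ≠ 0 := by
      rw [← spinorDensity_coe]; exact_mod_cast hS.ne'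
    have hs0' : star (s w) ≠ 0 := star_ne_zero.2 hs0
    have hS'' : χ₁ (τ w) * s w * star (χ₁ (τ w) * s w) +
        χ₂ (τ w) * star (s w) * star (χ₂ (τ w) * star (s w)) ≠ 0 := by
      have : χ₁ (τ w) * s w * star (χ₁ (τ w) * s w) +
        χ₂ (τ w) * star (s w) * star (χ₂ (τ w) * star (s w)) =
        (χ₁ (τ w) * star (χ₁ (τ w)) + χ₂ (τ w) * star (χ₂ (τ w))) * (s w * star (s w)) := by
        simp only [star_mul', star_star]; ring
      rw [this]
      exact mul_ne_zero hS' (mul_ne_zero hs0 hs0')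
    rw [div_mul_eq_mul_div, div_eq_div_iff hS'' hS']
    simp only [star_mul', star_star, star_pow, star_zero]
    ring
  rw [hf.energyCoeff_eq hφ hW hWφ hψ hwW, hf.energyCoeff_eq hχ hW' hWχ hψ' hwW', hpot,
    ← hsq w hwW₁, norm_pow, Complex.star_def, Complex.mul_conj, Complex.normSq_eq_norm_sq]
  push_cast
  ring

theorem IsConformalImmersion.isContinuousTwoForm (hf : IsConformalImmersion f) :
    IsContinuousTwoForm (M := M) (energyCoeff f) where
  continuousOn φ hφ := hf.continuousOn_energyCoeff hφ
  transform φ hφ χ hχ p hp := by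
    have hw : φ p ∈ (φ.symm.trans χ).source :=
      ⟨φ.map_source hp.1, by simpa [φ.left_inv hp.1] using hp.2⟩
    simpa [φ.left_inv hp.1] using hf.energyCoeff_transition hφ hχ hw

end EnergyForm

open MeasureTheory

/-! ### Stokes' theorem in the plane. -/

section Plane

/-- A continuous function on an open set with compact support there is integrable. -/
theorem ContinuousOn.integrableOn_of_eq_zero_off_compact {E : Type*} [NormedAddCommGroup E]
    {h : ℂ → E} {T K : Set ℂ} (hh : ContinuousOn h T) (hT : IsOpen T) (hK : IsCompact K)
    (hKT : K ⊆ T) (h0 : ∀ w ∈ T \ K, h w = 0) : IntegrableOn h T :=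
  ((hh.mono hKT).integrableOn_compact hK).of_forall_sdiff_eq_zero hT.measurableSet h0

/-- Integration by parts against the constant function $1$. -/
theorem integral_fderiv_eq_zero_of_hasCompactSupport {g : ℂ → ℂ} (hg : ContDiff ℝ 1 g)
    (hc : HasCompactSupport g) (v : ℂ) : ∫ w, fderiv ℝ g w v = 0 := by
  have h1 : Continuous fun w => fderiv ℝ g w v :=
    (hg.continuous_fderiv (by simp)).clm_apply continuous_const
  have h2 : HasCompactSupport fun w => fderiv ℝ g w v :=
    (hc.fderiv ℝ).comp_left (g := fun L : ℂ →L[ℝ] ℂ => L v) (by simp)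
  have := integral_mul_fderiv_eq_neg_fderiv_mul_of_integrable (μ := volume) (𝕜 := ℂ)
    (f := fun _ : ℂ => (1 : ℂ)) (g := g) (v := v) (by simp)
    (by simpa using h1.integrable_of_hasCompactSupport h2)
    (by simpa using hg.continuous.integrable_of_hasCompactSupport hc)
    (fun _ _ => differentiableAt_const _)
    (fun w _ => hg.differentiable (by simp) w)
  simpa using this

theorem integral_dzbar_eq_zero_of_hasCompactSupport {g : ℂ → ℂ} (hg : ContDiff ℝ 1 g)
    (hc : HasCompactSupport g) : ∫ w, dzbar g w = 0 := by
  have h1 (v : ℂ) : Integrable fun w => fderiv ℝ g w v :=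
    ((hg.continuous_fderiv (by simp)).clm_apply
      continuous_const).integrable_of_hasCompactSupport
      ((hc.fderiv ℝ).comp_left (g := fun L : ℂ →L[ℝ] ℂ => L v) (by simp))
  simp only [dzbar]
  rw [integral_div, integral_add (h1 1) ((h1 Complex.I).const_mul _), integral_const_mul,
    integral_fderiv_eq_zero_of_hasCompactSupport hg hc,
    integral_fderiv_eq_zero_of_hasCompactSupport hg hc]
  simp

/-- Stokes' theorem for a `(1,0)`-form with compact support in an open subset of the plane. -/
theorem setIntegral_dzbar_eq_zero {g : ℂ → ℂ} {T K : Set ℂ} (hg : ContDiffOn ℝ ∞ g T)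
    (hT : IsOpen T) (hK : IsCompact K) (hKT : K ⊆ T) (h0 : ∀ w ∈ T \ K, g w = 0) :
    ∫ w in T, dzbar g w = 0 := by
  -- Extension by zero is smooth across the boundary of `T`, because `g` vanishes on `T` outside the
  -- compact `K`.
  have hsupp : Function.support (T.indicator g) ⊆ K := by
    intro w hw
    by_contra hwK
    apply hw
    by_cases hwT : w ∈ T
    · rw [Set.indicator_of_mem hwT, h0 w ⟨hwT, hwK⟩]
    · exact Set.indicator_of_notMem hwT _
  have heq {w : ℂ} (hw : w ∈ T) : T.indicator g =ᶠ[nhds w] g := by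
    filter_upwards [hT.mem_nhds hw] with u hu using Set.indicator_of_mem hu _
  have hzero {w : ℂ} (hw : w ∉ K) : T.indicator g =ᶠ[nhds w] fun _ => 0 := by
    filter_upwards [hK.isClosed.isOpen_compl.mem_nhds hw] with u hu
    exact Function.notMem_support.1 fun h => hu (hsupp h)
  have hc : HasCompactSupport (T.indicator g) := HasCompactSupport.of_support_subset_isCompact hK hsupp
  have hsm : ContDiff ℝ 1 (T.indicator g) := by
    rw [contDiff_iff_contDiffAt]
    intro w
    by_cases hw : w ∈ K
    · exact (((hg.contDiffAt (hT.mem_nhds (hKT hw))).of_le (by simp)).congr_of_eventuallyEq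
        (heq (hKT hw)))
    · exact contDiffAt_const.congr_of_eventuallyEq (hzero hw)
  rw [← integral_dzbar_eq_zero_of_hasCompactSupport hsm hc,
    ← setIntegral_eq_integral_of_forall_compl_eq_zero (s := T) (f := dzbar (T.indicator g))]
  · exact setIntegral_congr_fun hT.measurableSet fun w hw => (dzbar_congr (heq hw)).symm
  · intro w hw
    rw [dzbar_congr (hzero fun h => hw (hKT h))]
    simp [dzbar]

theorem det_fderiv_real {τ : ℂ → ℂ} {w : ℂ} (hτ : DifferentiableAt ℂ τ w) :
    (fderiv ℝ τ w).det = ‖deriv τ w‖ ^ 2 := by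
  have h : ((fderiv ℝ τ w : ℂ →L[ℝ] ℂ) : ℂ →ₗ[ℝ] ℂ) =
      ((LinearMap.mulLeft ℂ (deriv τ w) : ℂ →ₗ[ℂ] ℂ)).restrictScalars ℝ := by
    ext v
    all_goals simp [fderiv_real_apply hτ]
  rw [ContinuousLinearMap.det, h, LinearMap.det_restrictScalars, Algebra.norm_complex_apply,
    Complex.normSq_eq_norm_sq]
  congr 2
  simp

end Plane

/-! ### Change of charts and Stokes' theorem on the closed surface. -/

section Charts

variable {M : Type*} [TopologicalSpace M]

theorem dzbar_eq_zero_of_notMem_tsupport {σ : M → ℝ} {g : ℂ → ℂ} {φ : OpenPartialHomeomorph M ℂ}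
    {w : ℂ} (hw : w ∈ φ.target) (hσ : φ.symm w ∉ tsupport σ) :
    dzbar (fun u => (σ (φ.symm u) : ℂ) * g u) w = 0 := by
  have h : (fun u => (σ (φ.symm u) : ℂ) * g u) =ᶠ[nhds w] fun _ => 0 := by
    filter_upwards [(φ.continuousAt_symm hw).preimage_mem_nhds
      ((isClosed_tsupport σ).isOpen_compl.mem_nhds hσ)] with u hu
    rw [image_eq_zero_of_notMem_tsupport hu]
    simp
  rw [dzbar_congr h]
  simp [dzbar]

theorem notMem_tsupport_of_notMem_image {σ : M → ℝ} {φ : OpenPartialHomeomorph M ℂ} {w : ℂ}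
    (hw : w ∈ φ.target \ φ '' tsupport σ) : φ.symm w ∉ tsupport σ :=
  fun h => hw.2 ⟨_, h, φ.right_inv hw.1⟩

/-- The image in a chart of the support of a function. -/
theorem isCompact_image_tsupport [CompactSpace M] {σ : M → ℝ} {φ : OpenPartialHomeomorph M ℂ}
    (hσ : tsupport σ ⊆ φ.source) : IsCompact (φ '' tsupport σ) ∧ φ '' tsupport σ ⊆ φ.target :=
  ⟨(isClosed_tsupport σ).isCompact.image_of_continuousOn (φ.continuousOn.mono hσ),
    fun _ ⟨_, hp, h⟩ => h ▸ φ.map_source (hσ hp)⟩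

theorem integrableOn_smul_of_tsupport_subset [CompactSpace M] {E : Type*} [NormedAddCommGroup E] [NormedSpace ℝ E]
    {ρ : M → ℝ} (hρ : Continuous ρ) {φ : OpenPartialHomeomorph M ℂ} (hs : tsupport ρ ⊆ φ.source)
    {c : ℂ → E} (hc : ContinuousOn c φ.target) :
    IntegrableOn (fun w => ρ (φ.symm w) • c w) φ.target := by
  obtain ⟨h1, h2⟩ := isCompact_image_tsupport hs
  refine ((hρ.comp_continuousOn φ.continuousOn_symm).smul
    hc).integrableOn_of_eq_zero_off_compact φ.open_target h1 h2 fun w hw => ?_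
  simp [image_eq_zero_of_notMem_tsupport (notMem_tsupport_of_notMem_image hw)]

variable [ChartedSpace ℂ M]

theorem chartAt_mem_maximalAtlas [IsManifold 𝓘(ℂ) ω M] (p : M) :
    chartAt ℂ p ∈ IsManifold.maximalAtlas 𝓘(ℂ) ω M :=
  IsManifold.chart_mem_maximalAtlas p

/-- The change of variables between two charts for the integral of a 2-form with support in
both. -/
theorem setIntegral_target_eq {E : Type*} [NormedAddCommGroup E] [NormedSpace ℝ E]
    {φ χ : OpenPartialHomeomorph M ℂ}
    (hφ : φ ∈ IsManifold.maximalAtlas 𝓘(ℂ) ω M) (hχ : χ ∈ IsManifold.maximalAtlas 𝓘(ℂ) ω M)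
    {a b : ℂ → E}
    (hab : ∀ w ∈ (φ.symm.trans χ).source,
      a w = ‖deriv (χ ∘ φ.symm) w‖ ^ 2 • b ((χ ∘ φ.symm) w))
    (ha : ∀ w ∈ φ.target, φ.symm w ∉ χ.source → a w = 0)
    (hb : ∀ w ∈ χ.target, χ.symm w ∉ φ.source → b w = 0) :
    ∫ w in φ.target, a w = ∫ w in χ.target, b w := by
  have hA : ∫ w in φ.target, a w = ∫ w in (φ.symm.trans χ).source, a w :=
    (setIntegral_eq_of_subset_of_forall_sdiff_eq_zero φ.open_target.measurableSet
      (fun w hw => hw.1) fun w hw => ha w hw.1 fun h => hw.2 ⟨hw.1, h⟩)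
  have hB : ∫ w in χ.target, b w = ∫ w in (φ.symm.trans χ).target, b w :=
    (setIntegral_eq_of_subset_of_forall_sdiff_eq_zero χ.open_target.measurableSet
      (fun w hw => hw.1) fun w hw => hb w hw.1 fun h => hw.2 ⟨hw.1, h⟩)
  rw [hA, hB, ← (φ.symm.trans χ).image_source_eq_target]
  have := integral_image_eq_integral_abs_det_fderiv_smul volume
    (φ.symm.trans χ).open_source.measurableSet
    (fun w hw => ((differentiableAt_transition hφ hχ hw).restrictScalars
      ℝ).hasFDerivAt.hasFDerivWithinAt) (φ.symm.trans χ).injOn b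
  refine Eq.trans ?_ this.symm
  refine setIntegral_congr_fun (φ.symm.trans χ).open_source.measurableSet fun w hw => ?_
  rw [det_fderiv_real (differentiableAt_transition hφ hχ hw), abs_of_nonneg (by positivity)]
  exact hab w hw

/-- The coefficients `G φ`, one for each holomorphic chart `φ`, define a smooth `(1,0)`-form
`G φ dz` on `M`. -/
structure IsSmoothOneForm (G : OpenPartialHomeomorph M ℂ → ℂ → ℂ) : Prop where
  contDiffOn : ∀ φ ∈ IsManifold.maximalAtlas 𝓘(ℂ) ω M, ContDiffOn ℝ ∞ (G φ) φ.target
  transform : ∀ φ ∈ IsManifold.maximalAtlas 𝓘(ℂ) ω M,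
    ∀ χ ∈ IsManifold.maximalAtlas 𝓘(ℂ) ω M, ∀ w ∈ (φ.symm.trans χ).source,
    G φ w = G χ ((χ ∘ φ.symm) w) * deriv (χ ∘ φ.symm) w

variable {G : OpenPartialHomeomorph M ℂ → ℂ → ℂ}

/-- The 2-form `∂̄G dz̄ ∧ dz`. -/
theorem IsSmoothOneForm.dzbar_transform (hG : IsSmoothOneForm G)
    {φ χ : OpenPartialHomeomorph M ℂ}
    (hφ : φ ∈ IsManifold.maximalAtlas 𝓘(ℂ) ω M) (hχ : χ ∈ IsManifold.maximalAtlas 𝓘(ℂ) ω M)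
    {w : ℂ} (hw : w ∈ (φ.symm.trans χ).source) :
    dzbar (G φ) w = ‖deriv (χ ∘ φ.symm) w‖ ^ 2 • dzbar (G χ) ((χ ∘ φ.symm) w) := by
  have hopen := (φ.symm.trans χ).open_source
  have hτ : DifferentiableOn ℂ (χ ∘ φ.symm) (φ.symm.trans χ).source := fun u hu =>
    (differentiableAt_transition hφ hχ hu).differentiableWithinAt
  have hτw := differentiableAt_transition hφ hχ hw
  have hτ' : DifferentiableAt ℂ (deriv (χ ∘ φ.symm)) w :=
    (hτ.deriv hopen).differentiableAt (hopen.mem_nhds hw)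
  have hGχ : DifferentiableAt ℝ (G χ) ((χ ∘ φ.symm) w) :=
    ((hG.contDiffOn χ hχ).contDiffAt
      (χ.open_target.mem_nhds (χ.map_source hw.2))).differentiableAt (by simp)
  -- The factor $\tau'$ is holomorphic, so $\bar\partial$ differentiates only $G_\chi\circ\tau$ and
  -- produces $\overline{\tau'}$.
  rw [dzbar_congr (Filter.eventuallyEq_of_mem (hopen.mem_nhds hw)
      (hG.transform φ hφ χ hχ)),
    dzbar_mul (g := fun u => G χ ((χ ∘ φ.symm) u)) (hGχ.comp w (hτw.restrictScalars ℝ))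
      (hτ'.restrictScalars ℝ), dzbar_of_differentiableAt hτ', dzbar_comp hGχ hτw,
    Complex.real_smul, Complex.ofReal_pow, ← Complex.mul_conj', Complex.star_def]
  ring

/-- The product of a smooth function and a smooth `(1,0)`-form. -/
theorem IsSmoothOneForm.smul (hG : IsSmoothOneForm G) {σ : M → ℝ}
    (hσ : ContMDiff 𝓘(ℝ, ℂ) 𝓘(ℝ, ℝ) ∞ σ) :
    IsSmoothOneForm fun φ w => (σ (φ.symm w) : ℂ) * G φ w where
  contDiffOn φ hφ :=
    (Complex.ofRealCLM.contDiff.comp_contDiffOn (hσ.contDiffOn_comp_symm hφ)).mul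
      (hG.contDiffOn φ hφ)
  transform φ hφ χ hχ w hw := by
    rw [hG.transform φ hφ χ hχ w hw, Function.comp_apply,
      χ.left_inv (show φ.symm w ∈ χ.source from hw.2)]
    ring

theorem IsSmoothOneForm.continuousOn_dzbar (hG : IsSmoothOneForm G)
    {φ : OpenPartialHomeomorph M ℂ} (hφ : φ ∈ IsManifold.maximalAtlas 𝓘(ℂ) ω M) :
    ContinuousOn (dzbar (G φ)) φ.target :=
  (hG.contDiffOn φ hφ).continuousOn_dzbar φ.open_target

variable [CompactSpace M]

variable [T2Space M]

theorem tsupport_chartPartition_subset (p : M) :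
    tsupport (chartPartition M p) ⊆ (chartAt ℂ p).source :=
  (exists_chartPartition M).choose_spec p

variable (M) in
/-- The finitely many indices of nonzero functions in the chart partition. -/
def chartIndices : Finset M :=
  ((chartPartition M).locallyFinite.finite_nonempty_of_compact).toFinset

theorem chartPartition_eq_zero {p : M} (hp : p ∉ chartIndices M) (x : M) :
    chartPartition M p x = 0 := by
  by_contra h
  exact hp (by
    simpa [chartIndices] using fun h0 : (chartPartition M p : M → ℝ) = 0 => h (congrFun h0 x))

theorem sum_chartPartition (x : M) : ∑ p ∈ chartIndices M, chartPartition M p x = 1 := by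
  rw [← (chartPartition M).sum_eq_one (Set.mem_univ x)]
  refine (finsum_eq_sum_of_support_subset _ fun p hp => ?_).symm
  by_contra h
  exact hp (chartPartition_eq_zero h x)

theorem surfaceIntegral_eq_sum {E : Type*} [NormedAddCommGroup E] [NormedSpace ℝ E]
    (c : OpenPartialHomeomorph M ℂ → ℂ → E) : surfaceIntegral (M := M) c =
      ∑ p ∈ chartIndices M, ∫ w in (chartAt ℂ p).target,
        chartPartition M p ((chartAt ℂ p).symm w) • c (chartAt ℂ p) w := by
  refine finsum_eq_sum_of_support_subset _ fun p hp => ?_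
  by_contra h
  exact hp (by simp [chartPartition_eq_zero h])

theorem surfaceIntegral_congr {E : Type*} [NormedAddCommGroup E] [NormedSpace ℝ E]
    {c d : OpenPartialHomeomorph M ℂ → ℂ → E}
    (h : ∀ p : M, ∀ w ∈ (chartAt ℂ p).target, c (chartAt ℂ p) w = d (chartAt ℂ p) w) :
    surfaceIntegral (M := M) c = surfaceIntegral (M := M) d := by
  refine finsum_congr fun p => setIntegral_congr_fun (chartAt ℂ p).open_target.measurableSet
    fun w hw => ?_
  simp only [h p w hw]

/-- The surface integral commutes with continuous linear maps. -/
theorem ContinuousLinearMap.surfaceIntegral_comp {E E' : Type*} [NormedAddCommGroup E]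
    [NormedSpace ℝ E] [CompleteSpace E] [NormedAddCommGroup E'] [NormedSpace ℝ E']
    [CompleteSpace E'] (L : E →L[ℝ] E') {c : OpenPartialHomeomorph M ℂ → ℂ → E}
    (hc : ∀ p : M, ContinuousOn (c (chartAt ℂ p)) (chartAt ℂ p).target) :
    surfaceIntegral (M := M) (fun φ w => L (c φ w)) = L (surfaceIntegral (M := M) c) := by
  rw [surfaceIntegral_eq_sum, surfaceIntegral_eq_sum, map_sum]
  refine Finset.sum_congr rfl fun p _ => ?_
  rw [← L.integral_comp_comm (integrableOn_smul_of_tsupport_subset (chartPartition M p).continuous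
    (tsupport_chartPartition_subset p) (hc p))]
  simp only [map_smul]

theorem surfaceIntegral_finset_sum {E ι : Type*} [NormedAddCommGroup E] [NormedSpace ℝ E]
    (s : Finset ι) {c : ι → OpenPartialHomeomorph M ℂ → ℂ → E}
    (hc : ∀ i ∈ s, ∀ p : M, ContinuousOn (c i (chartAt ℂ p)) (chartAt ℂ p).target) :
    surfaceIntegral (M := M) (fun φ w => ∑ i ∈ s, c i φ w) =
      ∑ i ∈ s, surfaceIntegral (M := M) (c i) := by
  simp only [surfaceIntegral_eq_sum]
  rw [Finset.sum_comm]
  refine Finset.sum_congr rfl fun p _ => ?_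
  simp only [Finset.smul_sum]
  exact integral_finsetSum _ fun i hi =>
    integrableOn_smul_of_tsupport_subset (chartPartition M p).continuous
      (tsupport_chartPartition_subset p) (hc i hi p)

variable [IsManifold 𝓘(ℂ) ω M]

/-- Stokes' theorem for a `(1,0)`-form with support in a chart. -/
theorem IsSmoothOneForm.surfaceIntegral_dzbar_smul (hG : IsSmoothOneForm G) {σ : M → ℝ}
    (hσ : ContMDiff 𝓘(ℝ, ℂ) 𝓘(ℝ, ℝ) ∞ σ) {χ : OpenPartialHomeomorph M ℂ}
    (hχ : χ ∈ IsManifold.maximalAtlas 𝓘(ℂ) ω M) (hs : tsupport σ ⊆ χ.source) :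
    surfaceIntegral (M := M) (fun φ => dzbar fun w => (σ (φ.symm w) : ℂ) * G φ w) = 0 := by
  have hH := hG.smul hσ
  obtain ⟨hK, hKχ⟩ := isCompact_image_tsupport hs
  -- Every term of the defining sum is moved to the one chart `χ`: off `χ.source` the function `σ`
  -- vanishes, and off the chart at `p` the partition function does.
  have hchart (p : M) : ∫ w in (chartAt ℂ p).target, chartPartition M p ((chartAt ℂ p).symm w) •
        dzbar (fun w => (σ ((chartAt ℂ p).symm w) : ℂ) * G (chartAt ℂ p) w) w =
      ∫ w in χ.target, chartPartition M p (χ.symm w) •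
        dzbar (fun w => (σ (χ.symm w) : ℂ) * G χ w) w := by
    refine setIntegral_target_eq (chartAt_mem_maximalAtlas p) hχ (fun w hw => ?_)
      (fun w hw hw' => ?_) fun w hw hw' => ?_
    · rw [hH.dzbar_transform (chartAt_mem_maximalAtlas p) hχ hw, Function.comp_apply,
        χ.left_inv (show (chartAt ℂ p).symm w ∈ χ.source from hw.2), smul_comm]
    · rw [dzbar_eq_zero_of_notMem_tsupport hw fun h => hw' (hs h), smul_zero]
    · rw [image_eq_zero_of_notMem_tsupport (f := chartPartition M p)
        fun h => hw' (tsupport_chartPartition_subset p h), zero_smul]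
  rw [surfaceIntegral_eq_sum, Finset.sum_congr rfl fun p _ => hchart p,
    ← integral_finsetSum]
  -- In the common chart the partition functions add up to $1$, leaving a planar integral of a
  -- compactly supported derivative.
  · simp only [← Finset.sum_smul, sum_chartPartition, one_smul]
    exact setIntegral_dzbar_eq_zero (hH.contDiffOn χ hχ) χ.open_target hK hKχ fun w hw => by
      rw [image_eq_zero_of_notMem_tsupport (notMem_tsupport_of_notMem_image hw)]; simp
  · intro p _
    refine (((chartPartition M p).continuous.comp_continuousOn χ.continuousOn_symm).smul
      (hH.continuousOn_dzbar hχ)).integrableOn_of_eq_zero_off_compact χ.open_target hK hKχ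
      fun w hw => ?_
    simp only [Pi.smul_apply', dzbar_eq_zero_of_notMem_tsupport hw.1
      (notMem_tsupport_of_notMem_image hw), smul_zero]

/-- Stokes' theorem for `(1,0)`-forms on a closed Riemann surface. -/
theorem IsSmoothOneForm.surfaceIntegral_dzbar (hG : IsSmoothOneForm G) :
    surfaceIntegral (M := M) (fun φ => dzbar (G φ)) = 0 := by
  have := isManifold_real M
  -- `chartPartition` is only continuous and cannot be put under $\bar\partial$, so a second, smooth
  -- partition cuts `G` into pieces supported in charts.
  obtain ⟨σ, hσ⟩ := SmoothPartitionOfUnity.exists_isSubordinate 𝓘(ℝ, ℂ)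
    (isClosed_univ (X := M)) (fun p : M => (chartAt ℂ p).source)
    (fun p => (chartAt ℂ p).open_source) fun p _ => Set.mem_iUnion.2 ⟨p, mem_chart_source ℂ p⟩
  set t := (σ.locallyFinite.finite_nonempty_of_compact).toFinset with ht
  have hsum (x : M) : ∑ q ∈ t, σ q x = 1 := by
    rw [← σ.sum_eq_one (Set.mem_univ x)]
    refine (finsum_eq_sum_of_support_subset _ fun q hq => ?_).symm
    simpa [ht] using fun h0 : (σ q : M → ℝ) = 0 => hq (congrFun h0 x)
  have hH (q : M) := hG.smul (σ q).contMDiff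
  calc surfaceIntegral (M := M) (fun φ => dzbar (G φ))
      = surfaceIntegral (M := M) (fun φ w => ∑ q ∈ t,
          dzbar (fun w => (σ q (φ.symm w) : ℂ) * G φ w) w) := by
        refine surfaceIntegral_congr fun p w hw => ?_
        have h1 : G (chartAt ℂ p) = fun w => ∑ q ∈ t,
            (σ q ((chartAt ℂ p).symm w) : ℂ) * G (chartAt ℂ p) w := by
          ext u
          rw [← Finset.sum_mul, ← Complex.ofReal_sum, hsum, Complex.ofReal_one, one_mul]
        have h2 (q : M) : DifferentiableAt ℝ
            (fun w => (σ q ((chartAt ℂ p).symm w) : ℂ) * G (chartAt ℂ p) w) w :=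
          (((hH q).contDiffOn _ (chartAt_mem_maximalAtlas p)).contDiffAt
            ((chartAt ℂ p).open_target.mem_nhds hw)).differentiableAt (by simp)
        conv_lhs => rw [h1]
        simp only [dzbar]
        rw [fderiv_fun_sum fun q _ => h2 q]
        simp only [_root_.sum_apply, Finset.mul_sum, ← Finset.sum_add_distrib, Finset.sum_div]
    _ = ∑ q ∈ t, surfaceIntegral (M := M)
          (fun φ => dzbar fun w => (σ q (φ.symm w) : ℂ) * G φ w) :=
        surfaceIntegral_finset_sum t fun q _ p =>
          (hH q).continuousOn_dzbar (chartAt_mem_maximalAtlas p)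
    _ = 0 := Finset.sum_eq_zero fun q _ =>
        hG.surfaceIntegral_dzbar_smul (σ q).contMDiff (chartAt_mem_maximalAtlas q) (hσ q)

end Charts

theorem IsConformalImmersion.isSmoothOneForm_zComp {M : Type*} [TopologicalSpace M]
    [ChartedSpace ℂ M] {f : M → Nil} (hf : IsConformalImmersion f) (k : Fin 3) :
    IsSmoothOneForm (M := M) fun φ w => zComp (f ∘ φ.symm) w k where
  contDiffOn φ hφ := (hf.conformalOn hφ).smooth.contDiffOn_zComp φ.open_target k
  transform _ hφ _ hχ _ hw := hf.zComp_transition hφ hχ hw k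

end

theorem mainTheorem7 {M : Type*} [TopologicalSpace M] [ChartedSpace ℂ M]
    [IsManifold 𝓘(ℂ) ω M] [CompactSpace M] [T2Space M]
    (f : M → Nil) (hf : IsConformalImmersion f) :
    (∀ φ ∈ IsManifold.maximalAtlas 𝓘(ℂ) ω M, ∀ w ∈ φ.target, ∃! c, IsEnergyCoeff f φ w c) ∧
    IsContinuousTwoForm (M := M) (energyCoeff f) ∧
    (spinorEnergy f).im = 0 ∧
    spinorEnergy f =
      ((surfaceIntegral (M := M) fun φ w =>
        meanCurvature (f ∘ φ.symm) w ^ 2 / 4 *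
            (‖(spinorAt f φ w).1‖ ^ 2 + ‖(spinorAt f φ w).2‖ ^ 2) ^ 2 -
          1 / 16 * (‖(spinorAt f φ w).2‖ ^ 2 - ‖(spinorAt f φ w).1‖ ^ 2) ^ 2 : ℝ) : ℂ) := by
  have hcont (p : M) := hf.continuousOn_energyCoeff (chartAt_mem_maximalAtlas p)
  have him : (spinorEnergy f).im = 0 := by
    have hZ := hf.isSmoothOneForm_zComp 2
    have h1 := Complex.imCLM.surfaceIntegral_comp hcont
    -- The real linear map $\zeta\mapsto\frac12\mathrm{Re}\,\zeta$ carries Stokes' identity for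
    -- $Z_3\,dz$ to the imaginary part of the energy density.
    have h2 := ((1 / 2 : ℝ) • Complex.reCLM).surfaceIntegral_comp (M := M)
      (c := fun φ => dzbar fun w => zComp (f ∘ φ.symm) w 2)
      fun p => hZ.continuousOn_dzbar (chartAt_mem_maximalAtlas p)
    rw [hZ.surfaceIntegral_dzbar, map_zero] at h2
    rw [spinorEnergy, ← Complex.imCLM_apply, ← h1, ← h2]
    refine surfaceIntegral_congr fun p w hw => ?_
    simpa using hf.im_energyCoeff (chartAt_mem_maximalAtlas p) hw
  refine ⟨fun φ hφ w hw => hf.existsUnique_isEnergyCoeff hφ hw, hf.isContinuousTwoForm, him, ?_⟩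
  apply Complex.ext
  · rw [spinorEnergy, ← Complex.reCLM_apply, ← Complex.reCLM.surfaceIntegral_comp hcont,
      Complex.ofReal_re]
    exact surfaceIntegral_congr fun p w hw => hf.re_energyCoeff (chartAt_mem_maximalAtlas p) hw
  · rw [him, Complex.ofReal_im]
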